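/- **Theorem 1.3.** For $d\ge 1$ let $X$ be a homogeneous Poisson point process of density $1$ in $\mathbb{R}^d$, and consider the point set $X\cup\{0\}$, i.e. the Poisson points together with an extra point at the origin. Let $\vec{\mathcal G}_d$ be the directed graph with vertex set $X\cup\{0\}$ that has an edge from $s$ to $t$ whenever $t$ is the nearest neighbour of $s$ (a point of $X\cup\{0\}$ other than $s$ at minimal Euclidean distance from $s$; almost surely it is unique), and let $\mathcal G_d$ be the undirected graph obtained by ignoring the directions of the edges. A *mini-loop* is a pair of points that are nearest neighbours of each other; almost surely each component of $\mathcal G_d$ contains exactly one mini-loop. The *generation number* of a point $x$ is one plus the graph distance in $\mathcal G_d$ from $x$ to the mini-loop in the component of $x$: the two points of the mini-loop have generation number $1$, and a point at graph distance $k-1$ from the mini-loop has generation number $k$. (On the null event that the component of $x$ has several mini-loops, take the distance to the nearest one; if it has none, the generation number is infinite.) Let $g_d(k)$ be the probability that the origin has generation number $k$. Then, for every integer $k\ge 1$, the event that the origin has generation number $k$ is measurable with respect to the completion of the underlying probability measure for every $d\ge 1$ (so that $g_d(k)$ is well defined), and $$\lim_{d\to\infty} g_d(k)=\frac{k}{(k+1)!}.$$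 -/

import Mathlib

open MeasureTheory ProbabilityTheory Filter Topology

/-- The directed nearest-neighbour graph on the points of a set `S`: there is an edge from `s` to
`t` if `t` is a nearest neighbour of `s` in `S`, i.e. a point of `S` other than `s` at minimal
distance from `s`. -/
def nnDigraph {E : Type*} [MetricSpace E] (S : Set E) : Digraph S where
  Adj s t := t ≠ s ∧ ∀ u : S, u ≠ s → dist s t ≤ dist s u

/-- The undirected nearest-neighbour graph: forget the directions of the edges. -/
def nnGraph {E : Type*} [MetricSpace E] (S : Set E) : SimpleGraph S :=
  (nnDigraph S).toSimpleGraphInclusive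

/-- The points that belong to a mini-loop, i.e. to a pair of points of `S` that are nearest
neighbours of each other. -/
def miniLoopPoints {E : Type*} [MetricSpace E] (S : Set E) : Set S :=
  {s | ∃ t : S, (nnDigraph S).Adj s t ∧ (nnDigraph S).Adj t s}

/-- The generation number of a point `x` of `S`: one plus the graph distance from `x` to the
mini-loop in the component of `x`. Here `edist x v = ⊤` if `v` is not in the component of `x`, so
that mini-loops in other components do not contribute, and the generation number is `⊤` if there is
no mini-loop in the component of `x`. -/
noncomputable def generationNumber {E : Type*} [MetricSpace E] (S : Set E) (x : S) : ℕ∞ :=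
  (⨅ v ∈ miniLoopPoints S, (nnGraph S).edist x v) + 1

/-- `X` is a homogeneous Poisson point process of density 1 in `ℝ^d` (`d ≥ 1`), viewed as a random
locally finite set of points, under the probability measure `P`: the number of points in a bounded
Borel set is a random variable that is Poisson distributed with mean the volume of the set, and the
numbers of points in disjoint bounded Borel sets are independent. -/
structure IsUnitPoissonProcess {Ω : Type*} [MeasurableSpace Ω] (P : Measure Ω) {d : ℕ}
    (X : Ω → Set (EuclideanSpace ℝ (Fin d))) : Prop where
  locallyFinite : ∀ (ω : Ω) (B : Set (EuclideanSpace ℝ (Fin d))),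
    Bornology.IsBounded B → (X ω ∩ B).Finite
  measurable_count : ∀ B : Set (EuclideanSpace ℝ (Fin d)),
    MeasurableSet B → Bornology.IsBounded B → Measurable fun ω => (X ω ∩ B).ncard
  map_count : ∀ B : Set (EuclideanSpace ℝ (Fin d)),
    MeasurableSet B → Bornology.IsBounded B →
      P.map (fun ω => (X ω ∩ B).ncard) = poissonMeasure (volume B).toNNReal
  indep_count : ∀ (n : ℕ) (B : Fin n → Set (EuclideanSpace ℝ (Fin d))),
    (∀ i, MeasurableSet (B i)) → (∀ i, Bornology.IsBounded (B i)) →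
      Pairwise (fun i j => Disjoint (B i) (B j)) →
        iIndepFun (fun (i : Fin n) (ω : Ω) => (X ω ∩ B i).ncard) P

/-- The event that the origin has generation number `k` in the nearest-neighbour graph on the points
of `X` together with an extra point at the origin. -/
def originGenerationEvent {Ω : Type*} {d : ℕ} (X : Ω → Set (EuclideanSpace ℝ (Fin d)))
    (k : ℕ) : Set Ω :=
  {ω | generationNumber (insert 0 (X ω)) ⟨0, Set.mem_insert 0 (X ω)⟩ = (k : ℕ∞)}

/-! Almost surely there are no ties, so nearest neighbours define a function, and the origin has
generation number `m + 1` exactly when the path 0 → p 1 → ⋯ → p (m + 1) of successive nearest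
neighbours first meets a mini-loop at p m (`generationNumber_eq_iff`). Given the points, this asks
that the balls around the p i with the successors on their boundaries contain no further point of
`X`. The union of these balls has at most the sum of their volumes, so the probability is at least
the integral of exp(-sum of volumes) over the chains whose own points respect the balls
(`IsUnitPoissonProcess.lintegral_chain_le`).

In terms of the steps of the chain, with ball volumes V_0, …, V_m, this integral is an expectation
over independent steps with standard exponential V_i. The ball around the last point contributes a
factor exp(-V_m), the probability that a further exponential V_{m+1} exceeds V_m. For large d the
steps are nearly orthogonal, and their lengths are comparable, being d-th roots of volumes. So a sum
of two or more consecutive steps is longer than the first of them, and only the condition V_0 > ⋯ >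
V_m remains. The lower bound thus tends to P(V_0 > ⋯ > V_m, V_{m+1} > V_m) = 1/(m+1)! - 1/(m+2)!
(`decreasingProb_le_lintegral`, `lintegral_stepWeight`).

No upper bound is needed: these numbers telescope to 1, while the probabilities add up to at most 1
(`tendsto_of_eventually_ge_of_sum_le_one`).

Both measurability and the integral bound rest on point counts in small cells. The events
`cellEvent` involve finitely many counts; for a fixed mesh they are disjoint, their union over all
meshes is the generation event up to a null set, and Fatou's lemma lets the mesh tend to zero. -/

/-! ### Distance to a 2-cycle in the graph of a function -/

section FunctionalGraph

variable {V : Type*}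

/-- In the undirected graph of a function `N`, a walk of length `n` from `x` to a point of a
`2`-cycle forces the orbit of `x` to reach a `2`-cycle within `n` steps. -/
lemma exists_iterate_mem_of_walk {G : SimpleGraph V} {N : V → V}
    (hG : ∀ a b, G.Adj a b → b = N a ∨ a = N b) {x v : V} (w : G.Walk x v)
    (hv : N (N v) = v) : ∃ i ≤ w.length, N (N (N^[i] x)) = N^[i] x := by
  induction w with
  | nil => exact ⟨0, le_rfl, hv⟩
  | @cons a b c hab w ih =>
    obtain ⟨i, hi, hloop⟩ := ih hv
    -- A forward edge puts the orbit of `b` one step ahead of that of `a`. After a backward edge the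
    -- orbit of `b` passes through `a`, unless `b` is already in a 2-cycle; but then so is `a = N
    -- b`.
    rcases hG _ _ hab with h | h
    · refine ⟨i + 1, by simpa using hi, ?_⟩
      rw [Function.iterate_succ_apply, ← h, hloop]
    · rcases i with _ | j
      · refine ⟨0, by simp, ?_⟩
        simp only [Function.iterate_zero, id] at hloop ⊢
        rw [h, hloop]
      · refine ⟨j, by simp; omega, ?_⟩
        rw [Function.iterate_succ_apply, ← h] at hloop
        exact hloop

lemma edist_iterate_le {G : SimpleGraph V} {N : V → V} (hG : ∀ a, G.Adj a (N a)) (x : V) (i : ℕ) :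
    G.edist x (N^[i] x) ≤ i := by
  induction i with
  | zero => simp
  | succ i ih =>
    calc G.edist x (N^[i + 1] x) ≤ G.edist x (N^[i] x) + G.edist (N^[i] x) (N^[i + 1] x) :=
          SimpleGraph.edist_triangle
      _ ≤ i + 1 := by
          refine add_le_add ih ?_
          rw [Function.iterate_succ_apply']
          exact (SimpleGraph.edist_eq_one_iff_adj.2 (hG _)).le
      _ = ((i + 1 : ℕ) : ℕ∞) := by push_cast; rfl

/-- Walking against the direction of the edges never shortens the way to a 2-cycle, so the
undirected distance can be read off the orbit. -/
lemma iInf_edist_eq_iInf_iterate {G : SimpleGraph V} {N : V → V}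
    (hG : ∀ a b, G.Adj a b → b = N a ∨ a = N b) (hG' : ∀ a, G.Adj a (N a)) (x : V) :
    (⨅ v ∈ {v | N (N v) = v}, G.edist x v) =
      ⨅ i ∈ {i : ℕ | N (N (N^[i] x)) = N^[i] x}, (i : ℕ∞) := by
  apply le_antisymm
  · refine le_iInf₂ fun i hi => ?_
    exact (iInf₂_le (f := fun v (_ : v ∈ {v | N (N v) = v}) => G.edist x v) (N^[i] x) hi).trans
      (edist_iterate_le hG' x i)
  · refine le_iInf₂ fun v hv => ?_
    by_cases h : G.edist x v = ⊤
    · simp [h]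
    · obtain ⟨w, hw⟩ := SimpleGraph.exists_walk_of_edist_ne_top h
      obtain ⟨i, hi, hl⟩ := exists_iterate_mem_of_walk hG w hv
      rw [← hw]
      exact (iInf₂_le i hl).trans (by exact_mod_cast hi)

lemma iInf_coe_eq_coe_iff (T : Set ℕ) (m : ℕ) :
    (⨅ i ∈ T, (i : ℕ∞)) = m ↔ m ∈ T ∧ ∀ i < m, i ∉ T := by
  constructor
  · intro h
    have hle : ∀ i ∈ T, m ≤ i := fun i hi => by
      have : (⨅ i ∈ T, (i : ℕ∞)) ≤ i := iInf₂_le i hi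
      rw [h] at this
      exact_mod_cast this
    refine ⟨?_, fun i hi hT => absurd (hle i hT) (by omega)⟩
    by_contra hm
    have : ((m + 1 : ℕ) : ℕ∞) ≤ ⨅ i ∈ T, (i : ℕ∞) := by
      refine le_iInf₂ fun i hi => ?_
      have h1 := hle i hi
      have h2 : i ≠ m := fun h => hm (h ▸ hi)
      exact_mod_cast (by omega : m + 1 ≤ i)
    rw [h] at this
    have : m + 1 ≤ m := by exact_mod_cast this
    omega
  · rintro ⟨hm, hlt⟩
    apply le_antisymm (iInf₂_le m hm)
    refine le_iInf₂ fun i hi => ?_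
    exact_mod_cast not_lt.1 fun h => hlt i h hi

end FunctionalGraph

/-! ### Generation numbers as chains of nearest neighbours -/

section NearestNeighbour

variable {E : Type*} [MetricSpace E]

/-- `t` is the unique nearest neighbour of `s` among the points of `S`. -/
def IsStrictNN (S : Set E) (s t : E) : Prop :=
  t ∈ S ∧ t ≠ s ∧ ∀ u ∈ S, u ≠ s → u ≠ t → dist s t < dist s u

/-- `p 0 → p 1 → ⋯ → p (m + 1)` is a chain of unique nearest neighbours that ends in the mini-loop
`{p m, p (m + 1)}` and does not meet a mini-loop before. -/
structure IsNNChain (S : Set E) (m : ℕ) (p : ℕ → E) : Prop where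
  step : ∀ i ≤ m, IsStrictNN S (p i) (p (i + 1))
  back : IsStrictNN S (p (m + 1)) (p m)
  ne : ∀ i < m, p (i + 2) ≠ p i

/-- No point of `S` has two other points of `S` at the same distance. -/
def NoTies (S : Set E) : Prop :=
  ∀ s ∈ S, ∀ t ∈ S, ∀ u ∈ S, t ≠ s → u ≠ s → dist s t = dist s u → t = u

lemma IsStrictNN.unique {S : Set E} {s t u : E} (h : IsStrictNN S s t) (h' : IsStrictNN S s u) :
    t = u := by
  by_contra hne
  exact lt_asymm (h.2.2 u h'.1 h'.2.1 (Ne.symm hne)) (h'.2.2 t h.1 h.2.1 hne)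

lemma IsNNChain.unique {S : Set E} {m : ℕ} {p p' : ℕ → E} (h : IsNNChain S m p)
    (h' : IsNNChain S m p') (h0 : p 0 = p' 0) : ∀ i ≤ m + 1, p i = p' i := by
  intro i
  induction i with
  | zero => exact fun _ => h0
  | succ i ih =>
    intro hi
    have h1 := h.step i (by omega)
    have h2 := h'.step i (by omega)
    rw [← ih (by omega)] at h2
    exact h1.unique h2

lemma IsNNChain.mem {S : Set E} {m : ℕ} {p : ℕ → E} (h : IsNNChain S m p) (h0 : p 0 ∈ S) :
    ∀ i ≤ m + 1, p i ∈ S := by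
  rintro (_ | i) hi
  · exact h0
  · exact (h.step i (by omega)).1

lemma NoTies.adj_iff {S : Set E} (hS : NoTies S) (s t : S) :
    (nnDigraph S).Adj s t ↔ IsStrictNN S (s : E) t := by
  constructor
  · rintro ⟨hne, h⟩
    refine ⟨t.2, fun h => hne (Subtype.ext h), fun u hu hus hut => ?_⟩
    have h1 : dist s t ≤ dist s ⟨u, hu⟩ := h ⟨u, hu⟩ fun h => hus (congrArg Subtype.val h)
    refine lt_of_le_of_ne h1 fun heq => hut ?_
    exact (hS s s.2 t t.2 u hu (fun h => hne (Subtype.ext h)) hus heq).symm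
  · rintro ⟨_, hne, h⟩
    refine ⟨fun h => hne (congrArg Subtype.val h), fun u hu => ?_⟩
    by_cases hut : u = t
    · rw [hut]
    · exact (h u u.2 (fun h => hu (Subtype.ext h)) fun h => hut (Subtype.ext h)).le

lemma NoTies.exists_isStrictNN {S : Set E} (hS : NoTies S)
    (hfin : ∀ (s : E) (r : ℝ), (S ∩ Metric.closedBall s r).Finite) {s t : E} (hs : s ∈ S)
    (ht : t ∈ S) (hne : t ≠ s) : ∃ u, IsStrictNN S s u := by
  have hF : ((S ∩ Metric.closedBall s (dist s t)) \ {s}).Finite :=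
    (hfin s (dist s t)).subset Set.sdiff_subset
  obtain ⟨u, ⟨⟨huS, hub⟩, hus⟩, hmin⟩ := Set.exists_min_image _ (fun u => dist s u) hF
    ⟨t, ⟨ht, by simp [dist_comm]⟩, by simpa using hne⟩
  refine ⟨u, huS, by simpa using hus, fun v hv hvs hvu => ?_⟩
  have hle : dist s u ≤ dist s v := by
    by_cases hvt : dist s v ≤ dist s t
    · exact hmin v ⟨⟨hv, by simpa [dist_comm] using hvt⟩, by simpa using hvs⟩
    · rw [Metric.mem_closedBall, dist_comm] at hub
      linarith
  exact lt_of_le_of_ne hle fun h => hvu (hS s hs u huS v hv (by simpa using hus) hvs h).symm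

/-- Without ties and with at least two points, the nearest-neighbour relation is the graph of a
function whose 2-cycles are the mini-loops, so the results on functional graphs apply. -/
lemma NoTies.exists_successor {S : Set E} (hS : NoTies S)
    (hfin : ∀ (s : E) (r : ℝ), (S ∩ Metric.closedBall s r).Finite) (hnt : S.Nontrivial) :
    ∃ N : S → S, (∀ s t : S, IsStrictNN S (s : E) t ↔ t = N s) ∧
      ∀ x : S, generationNumber S x = (⨅ i ∈ {i : ℕ | N (N (N^[i] x)) = N^[i] x}, (i : ℕ∞)) + 1 := by
  have hex : ∀ s : S, ∃ t : S, IsStrictNN S (s : E) t := fun s => by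
    obtain ⟨t, ht, hts⟩ := hnt.exists_ne (s : E)
    obtain ⟨u, hu⟩ := hS.exists_isStrictNN hfin s.2 ht hts
    exact ⟨⟨u, hu.1⟩, hu⟩
  choose N hN using hex
  have hiff : ∀ s t : S, IsStrictNN S (s : E) t ↔ t = N s :=
    fun s t => ⟨fun h => Subtype.ext (h.unique (hN s)), fun h => h ▸ hN s⟩
  refine ⟨N, hiff, fun x => ?_⟩
  have hadj : ∀ a b : S, (nnGraph S).Adj a b ↔ a ≠ b ∧ (b = N a ∨ a = N b) := fun a b => by
    rw [nnGraph, Digraph.toSimpleGraphInclusive, SimpleGraph.fromRel_adj, hS.adj_iff, hS.adj_iff,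
      hiff, hiff]
  have hne : ∀ a, a ≠ N a := fun a h => (hN a).2.1 (congrArg Subtype.val h.symm)
  have hloop : miniLoopPoints S = {v | N (N v) = v} := by
    ext v
    simp only [miniLoopPoints, Set.mem_ofPred_eq, hS.adj_iff, hiff]
    constructor
    · rintro ⟨t, rfl, h⟩
      exact h.symm
    · exact fun h => ⟨N v, rfl, h.symm⟩
  rw [generationNumber, hloop, iInf_edist_eq_iInf_iterate (fun a b h => ((hadj a b).1 h).2)
    (fun a => (hadj a _).2 ⟨hne a, Or.inl rfl⟩)]

lemma generationNumber_eq_iff {S : Set E} (hS : NoTies S)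
    (hfin : ∀ (s : E) (r : ℝ), (S ∩ Metric.closedBall s r).Finite) (x : S) (m : ℕ) :
    generationNumber S x = ((m + 1 : ℕ) : ℕ∞) ↔ ∃ p : ℕ → E, p 0 = x ∧ IsNNChain S m p := by
  by_cases hnt : S.Nontrivial
  · obtain ⟨N, hN, hgen⟩ := hS.exists_successor hfin hnt
    have hNs : ∀ s : S, IsStrictNN S (s : E) (N s) := fun s => (hN s _).2 rfl
    rw [hgen, Nat.cast_add, Nat.cast_one, (ENat.add_left_injective_of_ne_top ENat.one_ne_top).eq_iff,
      iInf_coe_eq_coe_iff]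
    simp only [Set.mem_ofPred_eq]
    constructor
    · rintro ⟨hm, hlt⟩
      refine ⟨fun i => (N^[i] x : S), rfl, fun i _ => ?_, ?_, fun i hi h => ?_⟩
      · simpa only [Function.iterate_succ_apply'] using hNs _
      · have := hNs (N (N^[m] x))
        rw [hm] at this
        simpa only [Function.iterate_succ_apply'] using this
      · simp only [Function.iterate_succ_apply'] at h
        exact hlt i hi (Subtype.ext h)
    · rintro ⟨p, hp0, hp⟩
      have hmem := hp.mem (hp0 ▸ x.2)
      have hiter : ∀ i ≤ m + 1, ((N^[i] x : S) : E) = p i := by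
        intro i
        induction i with
        | zero => exact fun _ => hp0.symm
        | succ i ih =>
          intro hi
          have h1 := hp.step i (by omega)
          rw [← ih (by omega)] at h1
          rw [Function.iterate_succ_apply']
          exact (hNs _).unique h1
      have hlast : ((N (N (N^[m] x)) : S) : E) = p m := by
        have h1 := hp.back
        rw [← hiter (m + 1) le_rfl] at h1
        rw [← Function.iterate_succ_apply' N m]
        exact (hNs _).unique h1
      refine ⟨Subtype.ext (by rw [hlast, hiter m (by omega)]), fun i hi h => hp.ne i hi ?_⟩
      rw [← hiter (i + 2) (by omega), ← hiter i (by omega), Function.iterate_succ_apply',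
        Function.iterate_succ_apply', h]
  -- With at most one point both sides fail: no mini-loop exists, so the infimum is `⊤`, and a chain
  -- needs a second point.
  · rw [Set.not_nontrivial_iff] at hnt
    constructor
    · intro h
      have : miniLoopPoints S = ∅ := by
        ext v
        simp only [Set.mem_empty_iff_false, iff_false]
        rintro ⟨t, h1, _⟩
        exact h1.1 (Subtype.ext (hnt t.2 v.2))
      rw [generationNumber, this] at h
      simp only [Set.mem_empty_iff_false, iInf_false, iInf_top, top_add] at h
      exact absurd h.symm (ENat.natCast_ne_top _)
    · rintro ⟨p, hp0, hp⟩
      have h := hp.step 0 (by omega)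
      exact absurd (hnt h.1 (hp0 ▸ x.2)) h.2.1

/-- Along a chain of nearest neighbours that meets no mini-loop the distances decrease. -/
lemma IsNNChain.dist_lt {S : Set E} {m : ℕ} {p : ℕ → E} (h : IsNNChain S m p) (h0 : p 0 ∈ S)
    {i : ℕ} (hi : i < m) : dist (p (i + 1)) (p (i + 2)) < dist (p i) (p (i + 1)) := by
  -- The point `p i` is itself a candidate for the nearest neighbour of `p (i + 1)`, and it loses to
  -- `p (i + 2)`.
  have h1 := (h.step (i + 1) (by omega)).2.2 (p i) (h.mem h0 i (by omega))
    (h.step i (by omega)).2.1.symm (h.ne i hi).symm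
  rwa [dist_comm (p (i + 1)) (p i)] at h1

end NearestNeighbour

/-! ### Countable partitions into small cells -/

section Cells

variable (E : Type*) [MetricSpace E] [TopologicalSpace.SeparableSpace E] [Nonempty E]

variable {E} in
lemma exists_dist_denseSeq_lt (n : ℕ) (x : E) :
    ∃ j, dist x (TopologicalSpace.denseSeq E j) < 1 / ((n : ℝ) + 1) := by
  have h := (TopologicalSpace.denseRange_denseSeq E).exists_dist_lt x
    (show (0 : ℝ) < 1 / ((n : ℝ) + 1) by positivity)
  simpa using h

variable {E} in
open Classical in
/-- The index of the cell that contains `x`, in a partition of the space into countably many cells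
of radius at most `1 / (n + 1)`. -/
noncomputable def cellIndex (n : ℕ) (x : E) : ℕ :=
  Nat.find (exists_dist_denseSeq_lt n x)

/-- The reference point of a cell. -/
noncomputable def cellPoint (j : ℕ) : E := TopologicalSpace.denseSeq E j

variable {E}

lemma dist_cellPoint_lt (n : ℕ) (x : E) :
    dist x (cellPoint E (cellIndex n x)) < 1 / ((n : ℝ) + 1) := by
  classical
  exact Nat.find_spec (exists_dist_denseSeq_lt n x)

lemma measurable_cellIndex [MeasurableSpace E] [OpensMeasurableSpace E] (n : ℕ) :
    Measurable (cellIndex n : E → ℕ) := by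
  classical
  exact measurable_find _ fun k => (isOpen_lt (by fun_prop) (by fun_prop)).measurableSet

variable (E) in
/-- The `j`-th cell. -/
def cell (n j : ℕ) : Set E := cellIndex n ⁻¹' {j}

lemma measurableSet_cell [MeasurableSpace E] [OpensMeasurableSpace E] (n j : ℕ) :
    MeasurableSet (cell E n j) :=
  measurable_cellIndex n (measurableSet_singleton j)

lemma cell_subset_ball (n j : ℕ) : cell E n j ⊆ Metric.ball (cellPoint E j) (1 / ((n : ℝ) + 1)) := by
  rintro x rfl
  exact dist_cellPoint_lt n x

lemma isBounded_cell (n j : ℕ) : Bornology.IsBounded (cell E n j) :=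
  Metric.isBounded_ball.subset (cell_subset_ball n j)

lemma disjoint_cell {n i j : ℕ} (h : i ≠ j) : Disjoint (cell E n i) (cell E n j) := by
  rw [Set.disjoint_left]
  rintro x rfl h'
  exact h h'

lemma eventually_cellIndex_ne {x y : E} (h : x ≠ y) :
    ∀ᶠ n in atTop, cellIndex n x ≠ cellIndex n y := by
  have h1 : Tendsto (fun n : ℕ => 1 / ((n : ℝ) + 1) + 1 / ((n : ℝ) + 1)) atTop (𝓝 (0 + 0)) :=
    tendsto_one_div_add_atTop_nhds_zero_nat.add tendsto_one_div_add_atTop_nhds_zero_nat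
  rw [add_zero] at h1
  filter_upwards [h1.eventually_lt_const (dist_pos.2 h)] with n hn heq
  have hx := dist_cellPoint_lt n x
  have hy := dist_cellPoint_lt n y
  rw [heq] at hx
  have := dist_triangle_right x y (cellPoint E (cellIndex n y))
  linarith

end Cells

/-! ### Null sets of configurations and absence of ties -/

section Poisson

variable {Ω : Type*} [MeasurableSpace Ω] {P : Measure Ω} {d : ℕ}
  {X : Ω → Set (EuclideanSpace ℝ (Fin d))}

lemma IsUnitPoissonProcess.measure_ncard_eq (hX : IsUnitPoissonProcess P X)
    {B : Set (EuclideanSpace ℝ (Fin d))} (hB : MeasurableSet B) (hb : Bornology.IsBounded B)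
    (n : ℕ) : P {ω | (X ω ∩ B).ncard = n} =
      ENNReal.ofReal (Real.exp (-(volume B).toReal) * (volume B).toReal ^ n / n.factorial) := by
  have h := congrArg (fun ν => ν {n}) (hX.map_count B hB hb)
  rw [Measure.map_apply (hX.measurable_count B hB hb) (measurableSet_singleton n),
    poissonMeasure_singleton] at h
  exact h

/-- This is 1 - exp(-v) ≤ v for the volume v of `B`. -/
lemma IsUnitPoissonProcess.measure_ncard_ne_zero_le [IsProbabilityMeasure P]
    (hX : IsUnitPoissonProcess P X)
    {B : Set (EuclideanSpace ℝ (Fin d))} (hB : MeasurableSet B) (hb : Bornology.IsBounded B) :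
    P {ω | (X ω ∩ B).ncard ≠ 0} ≤ volume B := by
  have hm : MeasurableSet {ω | (X ω ∩ B).ncard = 0} :=
    hX.measurable_count B hB hb (measurableSet_singleton 0)
  have hc : {ω | (X ω ∩ B).ncard ≠ 0} = {ω | (X ω ∩ B).ncard = 0}ᶜ := rfl
  rw [hc, prob_compl_eq_one_sub hm, hX.measure_ncard_eq hB hb, tsub_le_iff_right]
  have hv : volume B = ENNReal.ofReal (volume B).toReal :=
    (ENNReal.ofReal_toReal hb.measure_lt_top.ne).symm
  rw [hv, ENNReal.toReal_ofReal ENNReal.toReal_nonneg,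
    ← ENNReal.ofReal_add ENNReal.toReal_nonneg (by positivity), ← ENNReal.ofReal_one]
  apply ENNReal.ofReal_le_ofReal
  have := Real.add_one_le_exp (-(volume B).toReal)
  simp only [pow_zero, mul_one, Nat.factorial_zero, Nat.cast_one, div_one]
  linarith

lemma IsUnitPoissonProcess.measure_inter_ncard_mem (hX : IsUnitPoissonProcess P X) {m : ℕ}
    {B : Fin m → Set (EuclideanSpace ℝ (Fin d))} (hB : ∀ i, MeasurableSet (B i))
    (hb : ∀ i, Bornology.IsBounded (B i)) (hd : Pairwise fun i j => Disjoint (B i) (B j))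
    (T : Fin m → Set ℕ) :
    P {ω | ∀ i, (X ω ∩ B i).ncard ∈ T i} = ∏ i, P {ω | (X ω ∩ B i).ncard ∈ T i} := by
  have h := (hX.indep_count m B hB hb hd).meas_iInter
    (s := fun i => {ω | (X ω ∩ B i).ncard ∈ T i}) fun i => ⟨T i, trivial, rfl⟩
  rw [← h]
  congr 1
  ext ω
  simp

/-- The outer measure on `m`-tuples given by the probability that a tuple of points of `X`, with
the `i`-th point in `Q i`, lies in a set. -/
noncomputable def tupleOuterMeasure (P : Measure Ω) (X : Ω → Set (EuclideanSpace ℝ (Fin d)))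
    {m : ℕ} (Q : Fin m → Set (EuclideanSpace ℝ (Fin d))) :
    OuterMeasure (Fin m → EuclideanSpace ℝ (Fin d)) where
  measureOf B := P {ω | ∃ x ∈ B, ∀ i, x i ∈ X ω ∩ Q i}
  empty := by simp
  mono h := measure_mono fun ω ⟨x, hx, hx'⟩ => ⟨x, h hx, hx'⟩
  iUnion_nat s _ := by
    refine le_trans (measure_mono ?_) (measure_iUnion_le _)
    rintro ω ⟨x, hx, hx'⟩
    obtain ⟨i, hi⟩ := Set.mem_iUnion.1 hx
    exact Set.mem_iUnion.2 ⟨i, x, hi, hx'⟩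

/-- The product outer measure is the largest one bounded by products of volumes on boxes, so only
boxes matter. There the disjointness of the `Q i` gives independence of the counts. The sides of a
box are arbitrary sets and are replaced by measurable hulls of the same volume. -/
lemma IsUnitPoissonProcess.tupleOuterMeasure_le [IsProbabilityMeasure P]
    (hX : IsUnitPoissonProcess P X) {m : ℕ}
    {Q : Fin m → Set (EuclideanSpace ℝ (Fin d))} (hQ : ∀ i, MeasurableSet (Q i))
    (hb : ∀ i, Bornology.IsBounded (Q i)) (hd : Pairwise fun i j => Disjoint (Q i) (Q j)) :
    tupleOuterMeasure P X Q ≤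
      OuterMeasure.pi fun _ => (volume : Measure (EuclideanSpace ℝ (Fin d))).toOuterMeasure := by
  rw [OuterMeasure.le_pi]
  intro s _
  have hm : ∀ i, MeasurableSet (toMeasurable volume (s i) ∩ Q i) :=
    fun i => (measurableSet_toMeasurable _ _).inter (hQ i)
  have hb' : ∀ i, Bornology.IsBounded (toMeasurable volume (s i) ∩ Q i) :=
    fun i => (hb i).subset Set.inter_subset_right
  calc P {ω | ∃ x ∈ Set.pi Set.univ s, ∀ i, x i ∈ X ω ∩ Q i}
      ≤ P {ω | ∀ i, (X ω ∩ (toMeasurable volume (s i) ∩ Q i)).ncard ∈ ({0}ᶜ : Set ℕ)} := by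
        refine measure_mono ?_
        rintro ω ⟨x, hx, hx'⟩ i
        have hmem : x i ∈ X ω ∩ (toMeasurable volume (s i) ∩ Q i) :=
          ⟨(hx' i).1, subset_toMeasurable _ _ (hx i trivial), (hx' i).2⟩
        exact Set.ncard_ne_zero_of_mem hmem (hX.locallyFinite ω _ (hb' i))
    _ = ∏ i, P {ω | (X ω ∩ (toMeasurable volume (s i) ∩ Q i)).ncard ∈ ({0}ᶜ : Set ℕ)} :=
        hX.measure_inter_ncard_mem hm hb'
          (fun i j hij => (hd hij).mono Set.inter_subset_right Set.inter_subset_right) _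
    _ ≤ ∏ i, volume (s i) := by
        refine Finset.prod_le_prod' fun i _ => ?_
        refine (hX.measure_ncard_ne_zero_le (hm i) (hb' i)).trans ?_
        exact (measure_mono Set.inter_subset_left).trans (measure_toMeasurable _).le

/-- Almost surely, no tuple of distinct points of `X` lies in a given null set. -/
lemma IsUnitPoissonProcess.ae_forall_injective_notMem [IsProbabilityMeasure P]
    (hX : IsUnitPoissonProcess P X) {m : ℕ} {F : Set (Fin m → EuclideanSpace ℝ (Fin d))}
    (hF : volume F = 0) :
    ∀ᵐ ω ∂P, ∀ x : Fin m → EuclideanSpace ℝ (Fin d), Function.Injective x → (∀ i, x i ∈ X ω) →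
      x ∉ F := by
  have key : ∀ (n : ℕ) (q : Fin m → ℕ), Function.Injective q →
      P {ω | ∃ x ∈ F, ∀ i, x i ∈ X ω ∩ cell _ n (q i)} = 0 := by
    intro n q hq
    -- The product measure is known to agree with the product outer measure only on measurable sets.
    obtain ⟨F', hFF', hF'm, hF'0⟩ := exists_measurable_superset_of_null hF
    have h1 := hX.tupleOuterMeasure_le (Q := fun i => cell _ n (q i))
      (fun i => measurableSet_cell n _) (fun i => isBounded_cell n _)
      (fun i j hij => disjoint_cell (hq.ne hij)) F'
    rw [volume_pi, Measure.pi, toMeasure_apply _ _ hF'm] at hF'0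
    rw [hF'0] at h1
    refine measure_mono_null ?_ (nonpos_iff_eq_zero.1 h1)
    rintro ω ⟨x, hx, hx'⟩
    exact ⟨x, hFF' hx, hx'⟩
  have key' : ∀ᵐ ω ∂P, ∀ (n : ℕ) (q : Fin m → ℕ), Function.Injective q →
      ¬ ∃ x ∈ F, ∀ i, x i ∈ X ω ∩ cell _ n (q i) := by
    rw [ae_all_iff]; intro n
    rw [ae_all_iff]; intro q
    by_cases hq : Function.Injective q
    · have := key n q hq
      rw [measure_eq_zero_iff_ae_notMem] at this
      filter_upwards [this] with ω hω _
      exact hω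
    · exact Eventually.of_forall fun ω h => absurd h hq
  filter_upwards [key'] with ω hω x hx hxX hxF
  -- Distinct points eventually lie in distinct cells, so countably many choices of mesh and cells
  -- catch every injective tuple.
  have hev : ∀ᶠ n in atTop, ∀ i j, i ≠ j → cellIndex n (x i) ≠ cellIndex n (x j) := by
    refine eventually_all.2 fun i => eventually_all.2 fun j => ?_
    by_cases hij : i = j
    · exact Eventually.of_forall fun n h => absurd hij h
    · filter_upwards [eventually_cellIndex_ne (hx.ne hij)] with n hn _ using hn
  obtain ⟨n, hn⟩ := hev.exists
  refine hω n (fun i => cellIndex n (x i)) (fun i j h => ?_) ⟨x, hxF, fun i => ⟨hxX i, rfl⟩⟩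
  by_contra hij
  exact hn i j hij h

/-- By Fubini in the first coordinate: each slice lies in a sphere, which is null because d ≥ 1,
even when its radius is zero. -/
lemma volume_setOf_dist_eq_zero (hd : 1 ≤ d) {m : ℕ}
    {a : (Fin m → EuclideanSpace ℝ (Fin d)) → EuclideanSpace ℝ (Fin d)}
    {b : (Fin m → EuclideanSpace ℝ (Fin d)) → ℝ} (ha : Measurable a) (hb : Measurable b) :
    volume {x : Fin (m + 1) → EuclideanSpace ℝ (Fin d) |
      dist (a fun i => x i.succ) (x 0) = b fun i => x i.succ} = 0 := by
  have : Nonempty (Fin d) := ⟨⟨0, hd⟩⟩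
  let G : Set (EuclideanSpace ℝ (Fin d) × (Fin m → EuclideanSpace ℝ (Fin d))) :=
    {z | dist (a z.2) z.1 = b z.2}
  have hG : MeasurableSet G := measurableSet_eq_fun (by fun_prop) (by fun_prop)
  have hmp := volume_preserving_piFinSuccAbove (fun _ : Fin (m + 1) => EuclideanSpace ℝ (Fin d)) 0
  have h0 : volume G = 0 := by
    rw [Measure.volume_eq_prod, Measure.prod_apply_symm hG, lintegral_eq_zero_iff
      (measurable_measure_prodMk_right hG)]
    refine Eventually.of_forall fun y => ?_
    refine measure_mono_null ?_ (Measure.addHaar_sphere volume (a y) (b y))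
    intro u hu
    rw [Metric.mem_sphere, dist_comm]
    exact hu
  rw [← hmp.measure_preimage hG.nullMeasurableSet] at h0
  exact h0

/-- Almost surely the origin is not a point of `X`, and adding it creates no ties between
distances. -/
lemma IsUnitPoissonProcess.ae_noTies [IsProbabilityMeasure P]
    (hX : IsUnitPoissonProcess P X) (hd : 1 ≤ d) :
    ∀ᵐ ω ∂P, (0 : EuclideanSpace ℝ (Fin d)) ∉ X ω ∧ NoTies (insert 0 (X ω)) := by
  -- The four null sets: a point at the origin; two points equidistant from the origin; a point as
  -- far from the origin as from another point; a point equidistant from two others.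
  have h1 := hX.ae_forall_injective_notMem (volume_setOf_dist_eq_zero (m := 0) hd
    (a := fun _ => 0) (b := fun _ => 0) measurable_const measurable_const)
  have h2 := hX.ae_forall_injective_notMem (volume_setOf_dist_eq_zero (m := 1) hd
    (a := fun _ => 0) (b := fun x => dist 0 (x 0)) measurable_const (by fun_prop))
  have h3 := hX.ae_forall_injective_notMem (volume_setOf_dist_eq_zero (m := 1) hd
    (a := fun x => x 0) (b := fun x => dist (x 0) 0) (by fun_prop) (by fun_prop))
  have h4 := hX.ae_forall_injective_notMem (volume_setOf_dist_eq_zero (m := 2) hd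
    (a := fun x => x 0) (b := fun x => dist (x 0) (x 1)) (by fun_prop) (by fun_prop))
  filter_upwards [h1, h2, h3, h4] with ω h1 h2 h3 h4
  have h0 : (0 : EuclideanSpace ℝ (Fin d)) ∉ X ω := fun h =>
    h1 ![0] (fun i j _ => Subsingleton.elim (α := Fin 1) i j) (by simpa using h) (by simp)
  have e2 : ∀ t ∈ X ω, ∀ u ∈ X ω, t ≠ u → dist 0 u ≠ dist 0 t := fun t ht u hu htu h =>
    h2 ![u, t] (by rw [← List.nodup_ofFn]; simp [htu.symm]) (by simp [Fin.forall_fin_two, ht, hu])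
      (by simpa using h)
  have e3 : ∀ s ∈ X ω, ∀ u ∈ X ω, u ≠ s → dist s u ≠ dist s 0 := fun s hs u hu hus h =>
    h3 ![u, s] (by rw [← List.nodup_ofFn]; simp [hus]) (by simp [Fin.forall_fin_two, hs, hu])
      (by simpa using h)
  have e4 : ∀ s ∈ X ω, ∀ t ∈ X ω, ∀ u ∈ X ω, u ≠ s → t ≠ s → t ≠ u → dist s u ≠ dist s t :=
    fun s hs t ht u hu hus hts htu h =>
      h4 ![u, s, t] (by rw [← List.nodup_ofFn]; simp [hus, htu.symm, hts.symm])
        (by simp [Fin.forall_fin_succ, hs, ht, hu]) (by simpa using h)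
  refine ⟨h0, ?_⟩
  rintro s (rfl | hs) t (rfl | ht) u (rfl | hu) hts hus h
  · rfl
  · exact absurd rfl hts
  · exact absurd rfl hus
  · by_contra htu
    exact e2 t ht u hu htu h.symm
  · rfl
  · exact absurd h.symm (e3 s hs u hu hus)
  · exact absurd h (e3 s hs t ht hts)
  · by_contra htu
    exact e4 s hs t ht u hu hus hts htu h.symm

lemma IsUnitPoissonProcess.finite_insert_inter (hX : IsUnitPoissonProcess P X) (ω : Ω)
    {B : Set (EuclideanSpace ℝ (Fin d))} (hB : Bornology.IsBounded B) :
    (insert 0 (X ω) ∩ B).Finite := by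
  refine ((hX.locallyFinite ω B hB).insert 0).subset ?_
  rintro x ⟨rfl | hx, hxB⟩
  · exact Set.mem_insert _ _
  · exact Set.mem_insert_of_mem _ ⟨hx, hxB⟩

end Poisson

/-! ### Separated chains and stability under perturbation -/

section Chains

variable {E : Type*}

/-- The sequence `0, x 0, x 1, …`, continued by `0`. -/
def originSeq [Zero E] {k : ℕ} (x : Fin k → E) : ℕ → E
  | 0 => 0
  | i + 1 => if h : i < k then x ⟨i, h⟩ else 0

@[simp] lemma originSeq_zero [Zero E] {k : ℕ} (x : Fin k → E) : originSeq x 0 = 0 := rfl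

lemma originSeq_succ [Zero E] {k : ℕ} (x : Fin k → E) (i : Fin k) :
    originSeq x (i + 1) = x i := by
  simp [originSeq]

/-- The successor of the index `i` on a chain `0 → 1 → ⋯ → m + 1 → m`. -/
def chainNext (m i : ℕ) : ℕ := if i ≤ m then i + 1 else m

lemma chainNext_lt (m i : ℕ) : chainNext m i < m + 2 := by
  unfold chainNext; split_ifs <;> omega

lemma chainNext_ne {m i : ℕ} (hi : i < m + 2) : chainNext m i ≠ i := by
  unfold chainNext; split_ifs <;> omega

variable [MetricSpace E]

/-- The distance from the `i`-th point of a chain to its successor. -/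
noncomputable def chainRadius (m : ℕ) (p : ℕ → E) (i : ℕ) : ℝ := dist (p i) (p (chainNext m i))

lemma chainRadius_nonneg (m : ℕ) (p : ℕ → E) (i : ℕ) : 0 ≤ chainRadius m p i := dist_nonneg

/-- Each point of the chain is closer to its successor than to the other points of the chain, with
a margin `ε`. -/
structure IsSeparatedChain (m : ℕ) (p : ℕ → E) (ε : ℝ) : Prop where
  far : ∀ i < m + 2, ∀ j < m + 2, j ≠ i → j ≠ chainNext m i →
    chainRadius m p i + ε < dist (p i) (p j)
  pos : ∀ i < m + 2, ε < chainRadius m p i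

lemma IsSeparatedChain.lt_dist {m : ℕ} {p : ℕ → E} {ε : ℝ} (h : IsSeparatedChain m p ε)
    {i j : ℕ} (hi : i < m + 2) (hj : j < m + 2) (hij : i ≠ j) : ε < dist (p i) (p j) := by
  by_cases hn : j = chainNext m i
  · rw [hn]; exact h.pos i hi
  · have := h.far i hi j hj hij.symm hn
    have := chainRadius_nonneg m p i
    linarith

lemma isNNChain_iff {S : Set E} {m : ℕ} {p : ℕ → E} : IsNNChain S m p ↔
    (∀ i < m + 2, IsStrictNN S (p i) (p (chainNext m i))) ∧ ∀ i < m, p (i + 2) ≠ p i := by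
  constructor
  · refine fun h => ⟨fun i hi => ?_, h.ne⟩
    unfold chainNext
    split_ifs with him
    · exact h.step i him
    · obtain rfl : i = m + 1 := by omega
      exact h.back
  · rintro ⟨h, hne⟩
    refine ⟨fun i hi => ?_, ?_, hne⟩
    · simpa [chainNext, hi] using h i (by omega)
    · simpa [chainNext] using h (m + 1) (by omega)

/-- The step lengths strictly decrease, but a repeated point would repeat its step. If the
repetition involves the last point, its step back to `p m` has the length of step `m`, which gives
the same contradiction. -/
lemma IsNNChain.injOn {S : Set E} {m : ℕ} {p : ℕ → E} (h : IsNNChain S m p) (h0 : p 0 ∈ S)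
    {i j : ℕ} (hij : i < j) (hj : j < m + 2) : p i ≠ p j := by
  intro heq
  have hanti : ∀ i j, i < j → j ≤ m → dist (p j) (p (j + 1)) < dist (p i) (p (i + 1)) := by
    intro i j hij
    induction j, hij using Nat.le_induction with
    | base => exact fun hm => h.dist_lt h0 (by omega)
    | succ j hj ih => exact fun hm => (h.dist_lt h0 (by omega)).trans (ih (by omega))
  have hs := h.step i (by omega)
  by_cases hjm : j ≤ m
  · have h1 := hanti i j hij hjm
    rw [heq] at hs h1
    rw [hs.unique (h.step j hjm)] at h1
    exact lt_irrefl _ h1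
  · obtain rfl : j = m + 1 := by omega
    have hb := h.back
    rw [← heq] at hb
    have hp : p (i + 1) = p m := hs.unique hb
    rcases (show i ≤ m by omega).eq_or_lt with rfl | him
    · exact hs.2.1 hp
    · have h1 := hanti i m him le_rfl
      rw [heq, hp, dist_comm] at h1
      exact lt_irrefl _ h1

lemma IsNNChain.isSeparatedChain {S : Set E} {m : ℕ} {p : ℕ → E} (h : IsNNChain S m p)
    (h0 : p 0 ∈ S) : IsSeparatedChain m p 0 := by
  have hinj : ∀ i < m + 2, ∀ j < m + 2, i ≠ j → p i ≠ p j := fun i hi j hj hij => by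
    rcases hij.lt_or_gt with hlt | hlt
    · exact h.injOn h0 hlt hj
    · exact (h.injOn h0 hlt hi).symm
  have hs := (isNNChain_iff.1 h).1
  refine ⟨fun i hi j hj hji hjn => ?_, fun i hi => dist_pos.2 (hs i hi).2.1.symm⟩
  rw [add_zero]
  exact (hs i hi).2.2 (p j) (h.mem h0 j (by omega)) (hinj j hj i hi hji)
    (hinj j hj _ (chainNext_lt m i) hjn)

/-- The union of the balls that have to be empty for `p` to be a chain of nearest neighbours,
enlarged by `ρ`. -/
def chainRegion (m : ℕ) (p : ℕ → E) (ρ : ℝ) : Set E :=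
  ⋃ i ∈ Finset.range (m + 2), Metric.closedBall (p i) (chainRadius m p i + ρ)

lemma mem_chainRegion {m : ℕ} {p : ℕ → E} {ρ : ℝ} {u : E} :
    u ∈ chainRegion m p ρ ↔ ∃ i < m + 2, dist u (p i) ≤ chainRadius m p i + ρ := by
  simp [chainRegion]

lemma isClosed_chainRegion (m : ℕ) (p : ℕ → E) (ρ : ℝ) : IsClosed (chainRegion m p ρ) :=
  isClosed_biUnion_finset fun _ _ => Metric.isClosed_closedBall

lemma isBounded_chainRegion (m : ℕ) (p : ℕ → E) (ρ : ℝ) :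
    Bornology.IsBounded (chainRegion m p ρ) :=
  (Bornology.isBounded_biUnion_finset _).2 fun _ _ => Metric.isBounded_closedBall

/-- A chain of points of `S` close to a well separated chain `c` is a chain of nearest neighbours
if `S` has no other points close to `c`. -/
lemma IsSeparatedChain.isNNChain {S : Set E} {m : ℕ} {c p : ℕ → E} {δ : ℝ}
    (hc : IsSeparatedChain m c (4 * δ)) (hδ : 0 ≤ δ) (hp : ∀ i < m + 2, p i ∈ S)
    (hpc : ∀ i < m + 2, dist (p i) (c i) ≤ δ)
    (hS : ∀ u ∈ S, u ∈ chainRegion m c (3 * δ) → ∃ j < m + 2, u = p j) : IsNNChain S m p := by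
  -- Moving from `c` to `p` changes mutual distances by at most `2 * δ`. Hence a competitor of the
  -- successor of `p i` lies within the radius plus `3 * δ` of `c i`, while a separation by `4 * δ`
  -- leaves `2 * δ`, enough to absorb the change in the radius.
  have hclose : ∀ i < m + 2, ∀ j < m + 2,
      dist (p i) (p j) ≤ dist (c i) (c j) + 2 * δ ∧ dist (c i) (c j) ≤ dist (p i) (p j) + 2 * δ := by
    intro i hi j hj
    have h1 := dist_triangle4 (p i) (c i) (c j) (p j)
    have h2 := dist_triangle4 (c i) (p i) (p j) (c j)
    have h3 := hpc i hi
    have h4 := hpc j hj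
    rw [dist_comm (c j) (p j)] at h1
    rw [dist_comm (c i) (p i)] at h2
    constructor <;> linarith
  have hne : ∀ i < m + 2, ∀ j < m + 2, i ≠ j → p i ≠ p j := fun i hi j hj hij => by
    have h1 := hc.lt_dist hi hj hij
    have h2 := (hclose i hi j hj).2
    exact dist_pos.1 (by linarith)
  refine isNNChain_iff.2 ⟨fun i hi => ?_, fun i hi => hne _ (by omega) _ (by omega) (by omega)⟩
  have hn := chainNext_lt m i
  refine ⟨hp _ hn, hne _ hn _ hi (chainNext_ne hi), fun u hu hui hun => ?_⟩
  by_contra! hle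
  have h1 := (hclose i hi _ hn).1
  have hr : chainRadius m c i = dist (c i) (c (chainNext m i)) := rfl
  have hmem : u ∈ chainRegion m c (3 * δ) := by
    refine mem_chainRegion.2 ⟨i, hi, ?_⟩
    have h2 := dist_triangle u (p i) (c i)
    have h3 := hpc i hi
    rw [dist_comm u (p i)] at h2
    linarith
  obtain ⟨j, hj, rfl⟩ := hS u hu hmem
  have h4 := hc.far i hi j hj (fun h => hui (h ▸ rfl)) (fun h => hun (h ▸ rfl))
  have h5 := (hclose i hi j hj).2
  linarith

lemma IsSeparatedChain.eventually {m : ℕ} {p : ℕ → E}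
    (h : IsSeparatedChain m p 0) {c : ℕ → ℕ → E} {δ : ℕ → ℝ}
    (hc : ∀ i < m + 2, Tendsto (fun n => c n i) atTop (𝓝 (p i))) (hδ : Tendsto δ atTop (𝓝 0)) :
    ∀ᶠ n in atTop, IsSeparatedChain m (c n) (δ n) := by
  have hrad : ∀ i < m + 2, Tendsto (fun n => chainRadius m (c n) i) atTop
      (𝓝 (chainRadius m p i)) := fun i hi => (hc i hi).dist (hc _ (chainNext_lt m i))
  have e1 : ∀ᶠ n in atTop, ∀ i < m + 2, ∀ j < m + 2, j ≠ i → j ≠ chainNext m i →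
      chainRadius m (c n) i + δ n < dist (c n i) (c n j) := by
    simp only [← Finset.mem_range (n := m + 2)]
    refine (Filter.eventually_all_finset _).2 fun i hi => (Filter.eventually_all_finset _).2
      fun j hj => ?_
    rw [Finset.mem_range] at hi hj
    by_cases hji : j ≠ i ∧ j ≠ chainNext m i
    · filter_upwards [((hrad i hi).add hδ).eventually_lt ((hc i hi).dist (hc j hj))
        (h.far i hi j hj hji.1 hji.2)] with n hn _ _ using hn
    · exact Eventually.of_forall fun n h1 h2 => absurd ⟨h1, h2⟩ hji
  have e2 : ∀ᶠ n in atTop, ∀ i < m + 2, δ n < chainRadius m (c n) i := by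
    simp only [← Finset.mem_range (n := m + 2)]
    refine (Filter.eventually_all_finset _).2 fun i hi => ?_
    rw [Finset.mem_range] at hi
    exact hδ.eventually_lt (hrad i hi) (h.pos i hi)
  filter_upwards [e1, e2] with n h1 h2 using ⟨h1, h2⟩

/-- If `p` is a chain of nearest neighbours in a locally finite set, then so are small
perturbations. -/
lemma IsNNChain.eventually {S : Set E} (hfin : ∀ B : Set E, Bornology.IsBounded B → (S ∩ B).Finite)
    {m : ℕ} {p : ℕ → E} (h : IsNNChain S m p) (h0 : p 0 ∈ S) {c : ℕ → ℕ → E} {δ : ℕ → ℝ}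
    (hc : ∀ i < m + 2, Tendsto (fun n => c n i) atTop (𝓝 (p i))) (hδ : Tendsto δ atTop (𝓝 0)) :
    ∀ᶠ n in atTop, IsSeparatedChain m (c n) (4 * δ n) ∧
      ∀ u ∈ S, u ∈ chainRegion m (c n) (3 * δ n) → ∃ j < m + 2, u = p j := by
  have hsep := h.isSeparatedChain h0
  have hs := (isNNChain_iff.1 h).1
  have hrad : ∀ i < m + 2, Tendsto (fun n => chainRadius m (c n) i) atTop
      (𝓝 (chainRadius m p i)) := fun i hi => (hc i hi).dist (hc _ (chainNext_lt m i))
  have hδ4 : Tendsto (fun n => 4 * δ n) atTop (𝓝 0) := by simpa using hδ.const_mul 4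
  have hδ3 : Tendsto (fun n => 3 * δ n) atTop (𝓝 0) := by simpa using hδ.const_mul 3
  -- Enlarging the region by 1 makes the argument uniform: only finitely many points lie in the
  -- enlarged region, and by `e4` it eventually contains the perturbed regions.
  have e3 : ∀ᶠ n in atTop, ∀ i < m + 2, ∀ u ∈ S ∩ chainRegion m p 1,
      (∀ j < m + 2, u ≠ p j) → chainRadius m (c n) i + 3 * δ n < dist u (c n i) := by
    simp only [← Finset.mem_range (n := m + 2)]
    refine (Filter.eventually_all_finset _).2 fun i hi => (Filter.eventually_all_finite
      (hfin _ (isBounded_chainRegion m p 1))).2 fun u hu => ?_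
    rw [Finset.mem_range] at hi
    by_cases hup : ∀ j < m + 2, u ≠ p j
    · have hlt := (hs i hi).2.2 u hu.1 (hup i hi) (hup _ (chainNext_lt m i))
      filter_upwards [((hrad i hi).add hδ3).eventually_lt (tendsto_const_nhds.dist (hc i hi))
        (by rw [add_zero, dist_comm u]; exact hlt)] with n hn _ using hn
    · exact Eventually.of_forall fun n h1 => absurd (by simpa using h1) hup
  have e4 : ∀ᶠ n in atTop, ∀ i < m + 2,
      chainRadius m (c n) i + 3 * δ n + dist (c n i) (p i) < chainRadius m p i + 1 := by
    simp only [← Finset.mem_range (n := m + 2)]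
    refine (Filter.eventually_all_finset _).2 fun i hi => ?_
    rw [Finset.mem_range] at hi
    refine (((hrad i hi).add hδ3).add ((hc i hi).dist tendsto_const_nhds)).eventually_lt_const ?_
    simp
  filter_upwards [hsep.eventually hc hδ4, e3, e4] with n h1 h3 h4
  refine ⟨h1, fun u hu hur => ?_⟩
  obtain ⟨i, hi, hui⟩ := mem_chainRegion.1 hur
  by_contra! hne
  have hmem : u ∈ chainRegion m p 1 := by
    refine mem_chainRegion.2 ⟨i, hi, ?_⟩
    have := dist_triangle u (c n i) (p i)
    have := h4 i hi
    linarith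
  have := h3 i hi u ⟨hu, hmem⟩ hne
  linarith

end Chains

/-! ### Approximating the generation event by counts in cells -/

section GenerationEvent

variable {Ω : Type*} [MeasurableSpace Ω] {P : Measure Ω} {d : ℕ}
  {X : Ω → Set (EuclideanSpace ℝ (Fin d))} {m : ℕ}

/-- The sequence of the reference points of the cells with indices `q`, starting at the origin. -/
noncomputable def cellSeq (d : ℕ) {m : ℕ} (q : Fin (m + 1) → ℕ) : ℕ → EuclideanSpace ℝ (Fin d) :=
  originSeq fun i => cellPoint _ (q i)

/-- The event that the cells with indices `q` contain exactly one point of `X` each, and that there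
are no further points of `X` near the reference points of the cells that would prevent these
points from forming a chain of nearest neighbours. -/
def cellEvent (X : Ω → Set (EuclideanSpace ℝ (Fin d))) (n : ℕ) (q : Fin (m + 1) → ℕ) : Set Ω :=
  {ω | IsSeparatedChain m (cellSeq d q) (4 * (1 / ((n : ℝ) + 1))) ∧
    (∀ i, (X ω ∩ cell _ n (q i)).ncard = 1) ∧
    (X ω ∩ (chainRegion m (cellSeq d q) (3 * (1 / ((n : ℝ) + 1))) \
      ⋃ i, cell _ n (q i))).ncard = 0}

lemma measurableSet_region_diff (n : ℕ) (q : Fin (m + 1) → ℕ) (ρ : ℝ) :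
    MeasurableSet (chainRegion m (cellSeq d q) ρ \ ⋃ i, cell _ n (q i)) :=
  (isClosed_chainRegion _ _ _).measurableSet.diff
    (MeasurableSet.iUnion fun _ => measurableSet_cell n _)

lemma isBounded_region_diff (n : ℕ) (q : Fin (m + 1) → ℕ) (ρ : ℝ) :
    Bornology.IsBounded (chainRegion m (cellSeq d q) ρ \ ⋃ i, cell _ n (q i)) :=
  (isBounded_chainRegion _ _ _).subset Set.sdiff_subset

lemma IsUnitPoissonProcess.measurableSet_cellEvent (hX : IsUnitPoissonProcess P X) (n : ℕ)
    (q : Fin (m + 1) → ℕ) : MeasurableSet (cellEvent X n q) := by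
  have h1 : ∀ i, MeasurableSet {ω | (X ω ∩ cell _ n (q i)).ncard = 1} := fun i =>
    hX.measurable_count _ (measurableSet_cell n _) (isBounded_cell n _) (measurableSet_singleton 1)
  have h2 : MeasurableSet {ω | (X ω ∩ (chainRegion m (cellSeq d q) (3 * (1 / ((n : ℝ) + 1))) \
      ⋃ i, cell _ n (q i))).ncard = 0} :=
    hX.measurable_count _ (measurableSet_region_diff n q _) (isBounded_region_diff n q _)
      (measurableSet_singleton 0)
  have h3 : cellEvent X n q =
      {_ω : Ω | IsSeparatedChain m (cellSeq d q) (4 * (1 / ((n : ℝ) + 1)))} ∩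
        ((⋂ i, {ω | (X ω ∩ cell _ n (q i)).ncard = 1}) ∩
          {ω | (X ω ∩ (chainRegion m (cellSeq d q) (3 * (1 / ((n : ℝ) + 1))) \
            ⋃ i, cell _ n (q i))).ncard = 0}) := by
    ext ω
    simp [cellEvent]
  rw [h3]
  exact (MeasurableSet.const _).inter ((MeasurableSet.iInter h1).inter h2)

/-- The single points in the cells are within 1 / (n + 1) of the reference points and have no rivals
in the enlarged region, so `IsSeparatedChain.isNNChain` applies. -/
lemma IsUnitPoissonProcess.exists_isNNChain (hX : IsUnitPoissonProcess P X) {n : ℕ}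
    {q : Fin (m + 1) → ℕ} {ω : Ω} (h : ω ∈ cellEvent X n q) :
    ∃ x : Fin (m + 1) → EuclideanSpace ℝ (Fin d), (∀ i, cellIndex n (x i) = q i) ∧
      IsNNChain (insert 0 (X ω)) m (originSeq x) := by
  obtain ⟨hsep, hone, hzero⟩ := h
  have hδ : (0 : ℝ) ≤ 1 / ((n : ℝ) + 1) := by positivity
  choose x hx using fun i => Set.ncard_eq_one.1 (hone i)
  have hxm : ∀ i, x i ∈ X ω ∩ cell _ n (q i) := fun i => by rw [hx i]; rfl
  rw [Set.ncard_eq_zero (hX.locallyFinite ω _ (isBounded_region_diff n q _))] at hzero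
  refine ⟨x, fun i => (hxm i).2, hsep.isNNChain hδ ?_ ?_ ?_⟩
  · rintro (_ | i) hi
    · exact Set.mem_insert _ _
    · exact Set.mem_insert_of_mem _ (originSeq_succ x ⟨i, by omega⟩ ▸ (hxm _).1)
  · rintro (_ | i) hi
    · simpa [cellSeq] using hδ
    · have h1 : originSeq x (i + 1) = _ := originSeq_succ x ⟨i, by omega⟩
      have h2 : cellSeq d q (i + 1) = _ := originSeq_succ _ ⟨i, by omega⟩
      rw [h1, h2]
      have := cell_subset_ball n _ (hxm ⟨i, by omega⟩).2
      exact (Metric.mem_ball.1 this).le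
  · rintro u (rfl | hu) hur
    · exact ⟨0, by omega, rfl⟩
    · by_cases huc : u ∈ ⋃ i, cell _ n (q i)
      · obtain ⟨i, hi⟩ := Set.mem_iUnion.1 huc
        refine ⟨i + 1, by omega, ?_⟩
        have : u ∈ X ω ∩ cell _ n (q i) := ⟨hu, hi⟩
        rw [hx i] at this
        rw [originSeq_succ]
        exact this
      · have : u ∈ (∅ : Set (EuclideanSpace ℝ (Fin d))) := hzero ▸ ⟨hu, hur, huc⟩
        exact this.elim

/-- The chain starting at the origin is unique, and its points determine their cells. -/
lemma IsUnitPoissonProcess.pairwise_disjoint_cellEvent (hX : IsUnitPoissonProcess P X) (n : ℕ) :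
    Pairwise fun q q' : Fin (m + 1) → ℕ => Disjoint (cellEvent X n q) (cellEvent X n q') := by
  intro q q' hne
  rw [Set.disjoint_left]
  intro ω h h'
  obtain ⟨x, hxq, hx⟩ := hX.exists_isNNChain h
  obtain ⟨x', hxq', hx'⟩ := hX.exists_isNNChain h'
  refine hne (funext fun i => ?_)
  have := hx.unique hx' rfl (i + 1) (by omega)
  rw [originSeq_succ, originSeq_succ] at this
  rw [← hxq, ← hxq', this]

lemma tendsto_cellSeq (x : Fin (m + 1) → EuclideanSpace ℝ (Fin d)) (i : ℕ) :
    Tendsto (fun n => cellSeq d (fun j => cellIndex n (x j)) i) atTop (𝓝 (originSeq x i)) := by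
  rcases i with _ | i
  · exact tendsto_const_nhds
  · simp only [cellSeq, originSeq]
    split_ifs with h
    · rw [tendsto_iff_dist_tendsto_zero]
      refine squeeze_zero (fun _ => dist_nonneg) (fun n => ?_)
        tendsto_one_div_add_atTop_nhds_zero_nat
      rw [dist_comm]
      exact (dist_cellPoint_lt n _).le
    · exact tendsto_const_nhds

/-- On a fine mesh the points of the chain lie in different cells, and the enlarged region around
the reference points contains no other points of `X`. -/
lemma IsUnitPoissonProcess.eventually_mem_cellEvent (hX : IsUnitPoissonProcess P X) {ω : Ω}
    (h0 : (0 : EuclideanSpace ℝ (Fin d)) ∉ X ω) {p : ℕ → EuclideanSpace ℝ (Fin d)} (hp0 : p 0 = 0)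
    (hp : IsNNChain (insert 0 (X ω)) m p) :
    ∀ᶠ n in atTop, ω ∈ cellEvent X n fun i : Fin (m + 1) => cellIndex n (p (i + 1)) := by
  have hmem := hp.mem (hp0 ▸ Set.mem_insert _ _)
  have hps : ∀ i < m + 2, originSeq (fun i : Fin (m + 1) => p (i + 1)) i = p i := by
    rintro (_ | i) hi
    · exact hp0.symm
    · exact originSeq_succ _ ⟨i, by omega⟩
  have hX' : ∀ i < m + 1, p (i + 1) ∈ X ω := fun i hi => by
    refine (Set.mem_insert_iff.1 (hmem (i + 1) (by omega))).resolve_left fun h => ?_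
    exact hp.injOn (hp0 ▸ Set.mem_insert _ _) (Nat.succ_pos i) (by omega) (hp0.trans h.symm)
  have hev := hp.eventually (fun B hB => hX.finite_insert_inter ω hB) (hp0 ▸ Set.mem_insert _ _)
    (c := fun n => cellSeq d fun j : Fin (m + 1) => cellIndex n (p (j + 1)))
    (fun i hi => hps i hi ▸ tendsto_cellSeq _ i) tendsto_one_div_add_atTop_nhds_zero_nat
  have hne : ∀ᶠ n in atTop, ∀ i j : Fin (m + 1), i ≠ j →
      cellIndex n (p (i + 1)) ≠ cellIndex n (p (j + 1)) := by
    refine eventually_all.2 fun i => eventually_all.2 fun j => ?_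
    by_cases hij : i = j
    · exact Eventually.of_forall fun n h => absurd hij h
    · have : p (i + 1) ≠ p (j + 1) := by
        have hij' : (i : ℕ) ≠ j := fun h => hij (Fin.ext h)
        rcases hij'.lt_or_gt with h | h
        · exact hp.injOn (hp0 ▸ Set.mem_insert _ _) (by omega) (by omega)
        · exact (hp.injOn (hp0 ▸ Set.mem_insert _ _) (by omega) (by omega)).symm
      filter_upwards [eventually_cellIndex_ne this] with n hn _ using hn
  filter_upwards [hev, hne] with n ⟨hsep, hall⟩ hne
  have hδ : (0 : ℝ) < 1 / ((n : ℝ) + 1) := by positivity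
  have hex : ∀ u ∈ X ω, u ∈ chainRegion m
      (cellSeq d fun j : Fin (m + 1) => cellIndex n (p (j + 1))) (3 * (1 / ((n : ℝ) + 1))) →
      ∃ j : Fin (m + 1), u = p (j + 1) := fun u hu hur => by
    obtain ⟨j, hj, rfl⟩ := hall u (Set.mem_insert_of_mem _ hu) hur
    rcases j with _ | j
    · exact absurd (hp0 ▸ hu) h0
    · exact ⟨⟨j, by omega⟩, rfl⟩
  refine ⟨hsep, fun i => Set.ncard_eq_one.2 ⟨p (i + 1), ?_⟩, ?_⟩
  · ext u
    constructor
    · rintro ⟨hu, huc⟩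
      -- The cell is contained in the enlarged region, so each of its points belongs to the chain.
      obtain ⟨j, rfl⟩ := hex u hu (mem_chainRegion.2 ⟨i + 1, by omega, by
        have h1 := Metric.mem_ball.1 (cell_subset_ball n _ huc)
        rw [cellSeq, originSeq_succ]
        have := chainRadius_nonneg m
          (originSeq fun i : Fin (m + 1) => cellPoint (EuclideanSpace ℝ (Fin d))
            (cellIndex n (p (i + 1)))) (i + 1)
        linarith⟩)
      by_contra hji
      exact hne j i (fun h => hji (h ▸ rfl)) huc
    · rintro rfl
      exact ⟨hX' i i.2, rfl⟩
  · rw [Set.ncard_eq_zero (hX.locallyFinite ω _ (isBounded_region_diff n _ _))]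
    ext u
    simp only [Set.mem_inter_iff, Set.mem_empty_iff_false, iff_false]
    rintro ⟨hu, hur, huc⟩
    obtain ⟨j, rfl⟩ := hex u hu hur
    exact huc (Set.mem_iUnion.2 ⟨j, rfl⟩)

/-- Up to a null set, the generation event is a countable union of events that depend on the
numbers of points in finitely many sets. -/
lemma IsUnitPoissonProcess.originGenerationEvent_ae_eq [IsProbabilityMeasure P]
    (hX : IsUnitPoissonProcess P X) (hd : 1 ≤ d) (m : ℕ) :
    originGenerationEvent X (m + 1) =ᵐ[P] ⋃ n, ⋃ q : Fin (m + 1) → ℕ, cellEvent X n q := by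
  filter_upwards [hX.ae_noTies hd] with ω ⟨h0, hties⟩
  have hiff := generationNumber_eq_iff hties
    (fun s r => hX.finite_insert_inter ω Metric.isBounded_closedBall)
    ⟨0, Set.mem_insert 0 (X ω)⟩ m
  refine propext (hiff.trans ?_)
  constructor
  · rintro ⟨p, hp0, hp⟩
    obtain ⟨n, hn⟩ := (hX.eventually_mem_cellEvent h0 hp0 hp).exists
    exact Set.mem_iUnion.2 ⟨n, Set.mem_iUnion.2 ⟨_, hn⟩⟩
  · intro h
    obtain ⟨n, h⟩ := Set.mem_iUnion.1 h
    obtain ⟨q, h⟩ := Set.mem_iUnion.1 h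
    obtain ⟨x, _, hx⟩ := hX.exists_isNNChain h
    exact ⟨_, rfl, hx⟩

lemma IsUnitPoissonProcess.nullMeasurableSet_originGenerationEvent [IsProbabilityMeasure P]
    (hX : IsUnitPoissonProcess P X) (hd : 1 ≤ d) (m : ℕ) :
    NullMeasurableSet (originGenerationEvent X (m + 1)) P :=
  (MeasurableSet.iUnion fun n => MeasurableSet.iUnion fun q =>
    hX.measurableSet_cellEvent n q).nullMeasurableSet.congr
      (hX.originGenerationEvent_ae_eq hd m).symm

end GenerationEvent

/-! ### Lower bound by an integral over chains -/

section LowerBound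

variable {Ω : Type*} [MeasurableSpace Ω] {P : Measure Ω} {d : ℕ}
  {X : Ω → Set (EuclideanSpace ℝ (Fin d))} {m : ℕ}

/-- The volume of a ball of radius `r ≥ 0` in `ℝ^d`. -/
noncomputable def ballVolume (d : ℕ) (r : ℝ) : ℝ :=
  r ^ d * (volume (Metric.ball (0 : EuclideanSpace ℝ (Fin d)) 1)).toReal

lemma volume_closedBall_eq (x : EuclideanSpace ℝ (Fin d)) {r : ℝ} (hr : 0 ≤ r) :
    volume (Metric.closedBall x r) = ENNReal.ofReal (ballVolume d r) := by
  rw [Measure.addHaar_closedBall _ _ hr, finrank_euclideanSpace_fin, ballVolume,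
    ENNReal.ofReal_mul (by positivity), ENNReal.ofReal_toReal measure_ball_lt_top.ne]

lemma ballVolume_nonneg {r : ℝ} (hr : 0 ≤ r) : 0 ≤ ballVolume d r := by
  unfold ballVolume; positivity

@[fun_prop]
lemma continuous_ballVolume : Continuous (ballVolume d) := by
  unfold ballVolume; fun_prop

/-- The sum of the volumes of the balls around the points of a chain that have their successors on
the boundary, with the radii enlarged by `ρ`. -/
noncomputable def chainVolume (m : ℕ) (p : ℕ → EuclideanSpace ℝ (Fin d)) (ρ : ℝ) : ℝ :=
  ∑ i ∈ Finset.range (m + 2), ballVolume d (chainRadius m p i + ρ)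

lemma volume_chainRegion_le (p : ℕ → EuclideanSpace ℝ (Fin d)) {ρ : ℝ} (hρ : 0 ≤ ρ) :
    volume (chainRegion m p ρ) ≤ ENNReal.ofReal (chainVolume m p ρ) := by
  have hr : ∀ i, 0 ≤ chainRadius m p i + ρ := fun i => add_nonneg (chainRadius_nonneg m p i) hρ
  refine (measure_biUnion_finset_le _ _).trans ?_
  rw [chainVolume, ENNReal.ofReal_sum_of_nonneg fun i _ => ballVolume_nonneg (hr i)]
  exact Finset.sum_le_sum fun i _ => (volume_closedBall_eq _ (hr i)).le

/-- With U the region and C_i ⊆ U the cells, independence gives exp(-|U \ ⋃ C_i|) ∏ |C_i|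
exp(-|C_i|) = exp(-|U|) ∏ |C_i|. Then |U| is bounded by the sum of the ball volumes; overlaps only
help. -/
lemma IsUnitPoissonProcess.le_measure_cellEvent (hX : IsUnitPoissonProcess P X) {n : ℕ}
    {q : Fin (m + 1) → ℕ}
    (hsep : IsSeparatedChain m (cellSeq d q) (4 * (1 / ((n : ℝ) + 1)))) :
    ENNReal.ofReal (Real.exp (-chainVolume m (cellSeq d q) (3 * (1 / ((n : ℝ) + 1))))) *
      ∏ i, volume (cell (EuclideanSpace ℝ (Fin d)) n (q i)) ≤ P (cellEvent X n q) := by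
  have hδ : (0 : ℝ) < 1 / ((n : ℝ) + 1) := by positivity
  set δ : ℝ := 1 / ((n : ℝ) + 1) with hδdef
  set p := cellSeq d q with hp
  set U := chainRegion m p (3 * δ) with hU
  set C : Set (EuclideanSpace ℝ (Fin d)) := ⋃ i, cell _ n (q i) with hC
  -- Separation of the reference points forces the cells to be distinct, as independence requires.
  have hqinj : Function.Injective q := by
    intro i j hij
    by_contra hne
    have h1 := hsep.lt_dist (i := i + 1) (j := j + 1) (by omega) (by omega)
      (fun h => hne (Fin.ext (by omega)))
    rw [hp, cellSeq, originSeq_succ, originSeq_succ, hij, dist_self] at h1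
    linarith
  have hdisj : Pairwise fun i j => Disjoint (cell (EuclideanSpace ℝ (Fin d)) n (q i))
      (cell _ n (q j)) := fun i j hij => disjoint_cell (hqinj.ne hij)
  have hCU : C ⊆ U := by
    refine Set.iUnion_subset fun i u hu => mem_chainRegion.2 ⟨i + 1, by omega, ?_⟩
    have h1 := Metric.mem_ball.1 (cell_subset_ball n _ hu)
    have h2 := chainRadius_nonneg m p (i + 1)
    rw [hp, cellSeq, originSeq_succ]
    rw [hp, cellSeq] at h2
    linarith
  have hCm : MeasurableSet C := MeasurableSet.iUnion fun i => measurableSet_cell n _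
  let B : Fin (m + 2) → Set (EuclideanSpace ℝ (Fin d)) :=
    Fin.cons (U \ C) fun i => cell _ n (q i)
  let T : Fin (m + 2) → Set ℕ := Fin.cons {0} fun _ => {1}
  have hBm : ∀ i, MeasurableSet (B i) := by
    refine Fin.cases ?_ fun i => ?_
    · exact measurableSet_region_diff n q _
    · exact measurableSet_cell n _
  have hBb : ∀ i, Bornology.IsBounded (B i) := by
    refine Fin.cases ?_ fun i => ?_
    · exact isBounded_region_diff n q _
    · exact isBounded_cell n _
  have hUC : ∀ i, Disjoint (U \ C) (cell _ n (q i)) := fun i =>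
    Set.disjoint_sdiff_left.mono_right (Set.subset_iUnion (fun i => cell _ n (q i)) i)
  have hBd : Pairwise fun i j => Disjoint (B i) (B j) := by
    intro i j
    refine Fin.cases ?_ (fun i => ?_) i <;> refine Fin.cases ?_ (fun j => ?_) j
    · exact fun h => absurd rfl h
    · exact fun _ => hUC j
    · exact fun _ => (hUC i).symm
    · exact fun h => hdisj fun hij => h (congrArg Fin.succ hij)
  have hev : cellEvent X n q = {ω | ∀ i, (X ω ∩ B i).ncard ∈ T i} := by
    ext ω
    simp only [cellEvent, Set.mem_ofPred_eq, Fin.forall_fin_succ (n := m + 1)]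
    exact ⟨fun h => ⟨h.2.2, h.2.1⟩, fun h => ⟨hsep, h.2, h.1⟩⟩
  have hprod := hX.measure_inter_ncard_mem hBm hBb hBd T
  rw [← hev, Fin.prod_univ_succ] at hprod
  have h0 : P {ω | (X ω ∩ B 0).ncard ∈ T 0} =
      ENNReal.ofReal (Real.exp (-(volume (U \ C)).toReal)) := by
    have := hX.measure_ncard_eq (hBm 0) (hBb 0) 0
    simpa [T, B] using this
  have h1 : ∀ i : Fin (m + 1), P {ω | (X ω ∩ B i.succ).ncard ∈ T i.succ} =
      ENNReal.ofReal (Real.exp (-(volume (cell (EuclideanSpace ℝ (Fin d)) n (q i))).toReal)) *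
        volume (cell (EuclideanSpace ℝ (Fin d)) n (q i)) := by
    intro i
    have := hX.measure_ncard_eq (hBm i.succ) (hBb i.succ) 1
    have h2 : B i.succ = cell _ n (q i) := rfl
    rw [h2, pow_one, Nat.factorial_one, Nat.cast_one, div_one, ENNReal.ofReal_mul (by positivity),
      ENNReal.ofReal_toReal (isBounded_cell n (q i)).measure_lt_top.ne] at this
    exact this
  rw [hprod, h0, Finset.prod_congr rfl fun i _ => h1 i, Finset.prod_mul_distrib, ← mul_assoc,
    ← ENNReal.ofReal_prod_of_nonneg fun _ _ => by positivity,
    ← ENNReal.ofReal_mul (by positivity), ← Real.exp_sum, ← Real.exp_add]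
  refine mul_le_mul_left (ENNReal.ofReal_le_ofReal (Real.exp_le_exp.2 ?_)) _
  rw [Finset.sum_neg_distrib, ← neg_add, neg_le_neg_iff]
  have hvol : volume U = volume (U \ C) + ∑ i, volume (cell (EuclideanSpace ℝ (Fin d)) n (q i)) := by
    rw [← measure_sdiff_add_inter U hCm, Set.inter_eq_right.2 hCU, hC,
      measure_iUnion hdisj fun i => measurableSet_cell n _, tsum_fintype]
  have hle := volume_chainRegion_le (m := m) p (ρ := 3 * δ) (by positivity)
  rw [← hU, hvol] at hle
  have hnn : 0 ≤ chainVolume m p (3 * δ) := Finset.sum_nonneg fun i _ =>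
    ballVolume_nonneg (add_nonneg (chainRadius_nonneg m p i) (by positivity))
  have hfin : ∀ i, volume (cell (EuclideanSpace ℝ (Fin d)) n (q i)) ≠ ⊤ :=
    fun i => (isBounded_cell n _).measure_lt_top.ne
  have hle' := ENNReal.toReal_mono ENNReal.ofReal_ne_top hle
  rwa [ENNReal.toReal_ofReal hnn, ENNReal.toReal_add (isBounded_region_diff n q _).measure_lt_top.ne
    (ENNReal.sum_ne_top.2 fun i _ => hfin i), ENNReal.toReal_sum fun i _ => hfin i] at hle'

open Classical in
/-- A lower bound for the density of the chains of nearest neighbours, on the cells with indices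
`q`. -/
noncomputable def cellDensity (d : ℕ) {m : ℕ} (n : ℕ) (q : Fin (m + 1) → ℕ) : ENNReal :=
  if IsSeparatedChain m (cellSeq d q) (4 * (1 / ((n : ℝ) + 1))) then
    ENNReal.ofReal (Real.exp (-chainVolume m (cellSeq d q) (3 * (1 / ((n : ℝ) + 1))))) else 0

lemma measurable_cellIndex_pi (n : ℕ) :
    Measurable fun (x : Fin (m + 1) → EuclideanSpace ℝ (Fin d)) i => cellIndex n (x i) :=
  measurable_pi_lambda _ fun i => (measurable_cellIndex n).comp (measurable_pi_apply i)

/-- The integrand is constant on products of cells, so the integral is a sum over `q`, bounded term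
by term by probabilities of disjoint events. -/
lemma IsUnitPoissonProcess.lintegral_cellDensity_le [IsProbabilityMeasure P]
    (hX : IsUnitPoissonProcess P X) (hd : 1 ≤ d) (n : ℕ) :
    ∫⁻ x : Fin (m + 1) → EuclideanSpace ℝ (Fin d), cellDensity d n (fun i => cellIndex n (x i)) ≤
      P (originGenerationEvent X (m + 1)) := by
  rw [← lintegral_map (f := cellDensity d n) .of_discrete (measurable_cellIndex_pi n),
    lintegral_countable']
  calc ∑' q : Fin (m + 1) → ℕ, cellDensity d n q *
        (volume.map fun (x : Fin (m + 1) → EuclideanSpace ℝ (Fin d)) i => cellIndex n (x i)) {q}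
      ≤ ∑' q : Fin (m + 1) → ℕ, P (cellEvent X n q) := by
        refine ENNReal.tsum_le_tsum fun q => ?_
        rw [Measure.map_apply (measurable_cellIndex_pi n) (measurableSet_singleton q)]
        have hpre : (fun (x : Fin (m + 1) → EuclideanSpace ℝ (Fin d)) i => cellIndex n (x i)) ⁻¹'
            {q} = Set.pi Set.univ fun i => cell _ n (q i) := by
          ext x
          simp [cell, funext_iff]
        rw [hpre, volume_pi_pi, cellDensity]
        split_ifs with h
        · exact hX.le_measure_cellEvent h
        · simp
    _ = P (⋃ q : Fin (m + 1) → ℕ, cellEvent X n q) :=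
        (measure_iUnion (hX.pairwise_disjoint_cellEvent n)
          fun q => hX.measurableSet_cellEvent n q).symm
    _ ≤ P (⋃ n, ⋃ q : Fin (m + 1) → ℕ, cellEvent X n q) :=
        measure_mono (Set.subset_iUnion (fun n => ⋃ q : Fin (m + 1) → ℕ, cellEvent X n q) n)
    _ = P (originGenerationEvent X (m + 1)) :=
        (measure_congr (hX.originGenerationEvent_ae_eq hd m)).symm

/-- A lower bound for the probability that the origin has generation number `m + 1`, by an integral
over the chains of `m + 1` points. -/
lemma IsUnitPoissonProcess.lintegral_chain_le [IsProbabilityMeasure P]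
    (hX : IsUnitPoissonProcess P X) (hd : 1 ≤ d) (m : ℕ) :
    ∫⁻ x : Fin (m + 1) → EuclideanSpace ℝ (Fin d),
      {x | IsSeparatedChain m (originSeq x) 0}.indicator
        (fun x => ENNReal.ofReal (Real.exp (-chainVolume m (originSeq x) 0))) x ≤
      P (originGenerationEvent X (m + 1)) := by
  -- Fatou's lemma. Being separated with margin 0 is an open condition, so the discretised densities
  -- converge at every separated chain; elsewhere the lower bound 0 suffices.
  calc _ ≤ ∫⁻ x : Fin (m + 1) → EuclideanSpace ℝ (Fin d),
        liminf (fun n => cellDensity d n (fun i => cellIndex n (x i))) atTop := by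
        refine lintegral_mono fun x => ?_
        by_cases hx : IsSeparatedChain m (originSeq x) 0
        · rw [Set.indicator_of_mem (by exact hx)]
          have hc : ∀ i < m + 2, Tendsto (fun n => cellSeq d (fun j => cellIndex n (x j)) i) atTop
              (𝓝 (originSeq x i)) := fun i _ => tendsto_cellSeq x i
          have h4 : Tendsto (fun n : ℕ => 4 * (1 / ((n : ℝ) + 1))) atTop (𝓝 0) := by
            simpa using tendsto_one_div_add_atTop_nhds_zero_nat.const_mul (4 : ℝ)
          have h3 : Tendsto (fun n : ℕ => 3 * (1 / ((n : ℝ) + 1))) atTop (𝓝 0) := by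
            simpa using tendsto_one_div_add_atTop_nhds_zero_nat.const_mul (3 : ℝ)
          have hv : Tendsto (fun n => chainVolume m (cellSeq d fun j => cellIndex n (x j))
              (3 * (1 / ((n : ℝ) + 1)))) atTop (𝓝 (chainVolume m (originSeq x) 0)) := by
            refine tendsto_finsetSum _ fun i hi => ?_
            refine (continuous_ballVolume.tendsto _).comp (Tendsto.add ?_ h3)
            exact (hc i (Finset.mem_range.1 hi)).dist (hc _ (chainNext_lt m i))
          have ht : Tendsto (fun n => cellDensity d n (fun i => cellIndex n (x i))) atTop
              (𝓝 (ENNReal.ofReal (Real.exp (-chainVolume m (originSeq x) 0)))) := by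
            refine (ENNReal.tendsto_ofReal ((Real.continuous_exp.tendsto _).comp hv.neg)).congr' ?_
            filter_upwards [hx.eventually hc h4] with n hn
            rw [cellDensity, if_pos hn]
            rfl
          exact ht.liminf_eq.ge
        · rw [Set.indicator_of_notMem (by exact hx)]
          exact zero_le
    _ ≤ liminf (fun n => ∫⁻ x : Fin (m + 1) → EuclideanSpace ℝ (Fin d),
          cellDensity d n (fun i => cellIndex n (x i))) atTop :=
        lintegral_liminf_le fun n =>
          (Measurable.of_discrete (f := cellDensity d n)).comp (measurable_cellIndex_pi n)
    _ ≤ P (originGenerationEvent X (m + 1)) :=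
        liminf_le_of_le (by isBoundedDefault) fun b hb => by
          obtain ⟨n, hn⟩ := hb.exists
          exact hn.trans (hX.lintegral_cellDensity_le hd n)

end LowerBound

/-! ### Change of variables from points to steps -/

section PartialSums

/-- The sequence of the partial sums of `y`. -/
def partialSums {E : Type*} [AddCommMonoid E] {k : ℕ} (y : Fin k → E) (i : Fin k) : E :=
  ∑ a, if a ≤ i then y a else 0

/-- By induction: once the first coordinate is split off, the map is a skew product that translates
the partial sums of the rest by the first coordinate. -/
lemma measurePreserving_partialSums {E : Type*} [NormedAddCommGroup E] [MeasureSpace E]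
    [BorelSpace E] [SecondCountableTopology E] [(volume : Measure E).IsAddLeftInvariant]
    [SigmaFinite (volume : Measure E)] (k : ℕ) :
    MeasurePreserving (partialSums : (Fin k → E) → Fin k → E) := by
  induction k with
  | zero =>
    have : (partialSums : (Fin 0 → E) → Fin 0 → E) = id := by
      ext y i
      exact i.elim0
    rw [this]
    exact MeasurePreserving.id _
  | succ k ih =>
    have he := volume_preserving_piFinSuccAbove (fun _ : Fin (k + 1) => E) 0
    have hS : MeasurePreserving
        (fun z : E × (Fin k → E) => (z.1, (fun _ : Fin k => z.1) + partialSums z.2)) := by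
      refine (MeasurePreserving.id (volume : Measure E)).skew_product
        (g := fun (a : E) (y : Fin k → E) => (fun _ : Fin k => a) + partialSums y) ?_
        (Eventually.of_forall fun a => ?_)
      · have h1 : Measurable fun z : E × (Fin k → E) => partialSums z.2 :=
          ih.measurable.comp measurable_snd
        exact (measurable_pi_lambda _ fun _ => measurable_fst).add h1
      · exact ((measurePreserving_add_left (volume : Measure (Fin k → E)) _).comp ih).map_eq
    have hcomp := (he.symm.comp hS).comp he
    convert hcomp using 1
    funext y
    refine (MeasurableEquiv.piFinSuccAbove (fun _ : Fin (k + 1) => E) 0).injective ?_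
    rw [Function.comp_apply, Function.comp_apply, MeasurableEquiv.apply_symm_apply]
    refine Prod.ext ?_ (funext fun i => ?_)
    · change (∑ a, if a ≤ (0 : Fin (k + 1)) then y a else 0) = y 0
      simp
    · change (∑ a, if a ≤ i.succ then y a else 0) = y 0 + ∑ a, if a ≤ i then y a.succ else 0
      simp [Fin.sum_univ_succ]

lemma originSeq_partialSums {E : Type*} [AddCommMonoid E] {k : ℕ} (y : Fin k → E) {i : ℕ}
    (hi : i ≤ k) : originSeq (partialSums y) i = ∑ a : Fin k, if (a : ℕ) < i then y a else 0 := by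
  rcases i with _ | i
  · simp
  · have h : originSeq (partialSums y) (i + 1) = _ := originSeq_succ _ ⟨i, hi⟩
    rw [h, partialSums]
    refine Finset.sum_congr rfl fun a _ => ?_
    simp only [Fin.le_def, Nat.lt_succ_iff]

lemma dist_originSeq_partialSums {E : Type*} [NormedAddCommGroup E] {k : ℕ} (y : Fin k → E)
    {i j : ℕ} (hij : i ≤ j) (hj : j ≤ k) :
    dist (originSeq (partialSums y) i) (originSeq (partialSums y) j) =
      ‖∑ a ∈ Finset.univ.filter (fun a : Fin k => i ≤ (a : ℕ) ∧ (a : ℕ) < j), y a‖ := by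
  rw [dist_eq_norm', originSeq_partialSums y (hij.trans hj), originSeq_partialSums y hj,
    ← Finset.sum_sub_distrib, Finset.sum_filter]
  congr 1
  refine Finset.sum_congr rfl fun a _ => ?_
  split_ifs <;> first | omega | simp

lemma dist_originSeq_partialSums_succ {E : Type*} [NormedAddCommGroup E] {k : ℕ} (y : Fin k → E)
    (i : Fin k) :
    dist (originSeq (partialSums y) i) (originSeq (partialSums y) (i + 1)) = ‖y i‖ := by
  rw [dist_originSeq_partialSums y (Nat.le_succ _) (by omega)]
  congr 1
  have : Finset.univ.filter (fun a : Fin k => (i : ℕ) ≤ a ∧ (a : ℕ) < i + 1) = {i} := by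
    ext a
    simp [Fin.ext_iff]
    omega
  rw [this, Finset.sum_singleton]

/-- The conditions on the steps of a chain under which the chain is separated. -/
structure IsGoodSteps {E : Type*} [NormedAddCommGroup E] {m : ℕ} (y : Fin (m + 1) → E) : Prop where
  pos : ∀ i, 0 < ‖y i‖
  anti : ∀ i j, i < j → ‖y j‖ < ‖y i‖
  far : ∀ (i : Fin (m + 1)) (j : ℕ), (i : ℕ) + 2 ≤ j → j ≤ m + 1 →
    ‖y i‖ < ‖∑ a ∈ Finset.univ.filter (fun a : Fin (m + 1) => (i : ℕ) ≤ a ∧ (a : ℕ) < j), y a‖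

lemma chainRadius_partialSums {E : Type*} [NormedAddCommGroup E] {m : ℕ} (y : Fin (m + 1) → E)
    (i : Fin (m + 1)) : chainRadius m (originSeq (partialSums y)) i = ‖y i‖ := by
  rw [← dist_originSeq_partialSums_succ, chainRadius, chainNext, if_pos (by omega)]

lemma chainRadius_partialSums_last {E : Type*} [NormedAddCommGroup E] {m : ℕ}
    (y : Fin (m + 1) → E) :
    chainRadius m (originSeq (partialSums y)) (m + 1) = ‖y (Fin.last m)‖ := by
  rw [← dist_originSeq_partialSums_succ, chainRadius, chainNext, if_neg (by omega), dist_comm]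
  rfl

/-- Points further ahead are excluded by `far`. For an earlier point `j`, the distance is at least
the length of step `j`, and the steps decrease; `far` makes the inequality strict where the last
radius repeats step `m`. -/
lemma IsGoodSteps.isSeparatedChain {E : Type*} [NormedAddCommGroup E] {m : ℕ}
    {y : Fin (m + 1) → E} (h : IsGoodSteps y) :
    IsSeparatedChain m (originSeq (partialSums y)) 0 := by
  have hrad : ∀ i (hi : i ≤ m), chainRadius m (originSeq (partialSums y)) i = ‖y ⟨i, by omega⟩‖ :=
    fun i hi => chainRadius_partialSums y ⟨i, by omega⟩
  have hlast := chainRadius_partialSums_last y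
  have hdist : ∀ i (hi : i ≤ m), dist (originSeq (partialSums y) i)
      (originSeq (partialSums y) (i + 1)) = ‖y ⟨i, by omega⟩‖ :=
    fun i hi => dist_originSeq_partialSums_succ y ⟨i, by omega⟩
  have hfar : ∀ i j (hij : i + 2 ≤ j) (hj : j ≤ m + 1), ‖y ⟨i, by omega⟩‖ <
      dist (originSeq (partialSums y) i) (originSeq (partialSums y) j) := fun i j hij hj => by
    rw [dist_originSeq_partialSums y (by omega) (by omega)]
    exact h.far ⟨i, by omega⟩ j hij hj
  have hle : ∀ i j (hij : i < j) (hj : j < m + 2),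
      chainRadius m (originSeq (partialSums y)) j ≤ ‖y ⟨i, by omega⟩‖ := fun i j hij hj => by
    by_cases hjm : j ≤ m
    · rw [hrad j hjm]
      exact (h.anti _ _ hij).le
    · obtain rfl : j = m + 1 := by omega
      rw [hlast]
      rcases (show i ≤ m by omega).eq_or_lt with rfl | him
      · exact le_rfl
      · exact (h.anti ⟨i, by omega⟩ (Fin.last m) him).le
  refine ⟨fun i hi j hj hji hjn => ?_, fun i hi => ?_⟩
  · rw [add_zero]
    rcases hji.lt_or_gt with hlt | hlt
    · rw [dist_comm]
      by_cases hji' : j + 2 ≤ i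
      · exact (hle j i hlt hi).trans_lt (hfar j i hji' (by omega))
      · obtain rfl : i = j + 1 := by omega
        -- For `j = m` the point `i = m + 1` has `j` as its successor, which `hjn` excludes.
        have hjm : j + 1 ≤ m := by
          by_contra hjm
          rw [chainNext, if_neg hjm] at hjn
          omega
        rw [hrad _ hjm, hdist j (by omega)]
        exact h.anti _ _ (Nat.lt_succ_self j)
    · have him : i ≤ m := by omega
      rw [chainNext, if_pos him] at hjn
      rw [hrad i him]
      exact hfar i j (by omega) (by omega)
  · by_cases him : i ≤ m
    · rw [hrad i him]; exact h.pos _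
    · obtain rfl : i = m + 1 := by omega
      rw [hlast]; exact h.pos _

variable {d : ℕ}

/-- The volume of the ball around the origin with `y` on its boundary. -/
noncomputable def radialVolume (y : EuclideanSpace ℝ (Fin d)) : ℝ := ballVolume d ‖y‖

/-- The last step counts twice, for the balls around both points of the mini-loop. -/
lemma chainVolume_partialSums {m : ℕ} (y : Fin (m + 1) → EuclideanSpace ℝ (Fin d)) :
    chainVolume m (originSeq (partialSums y)) 0 =
      ∑ i, radialVolume (y i) + radialVolume (y (Fin.last m)) := by
  rw [chainVolume, Finset.sum_range_succ, chainRadius_partialSums_last, Finset.sum_range]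
  simp only [chainRadius_partialSums, add_zero]
  rfl

lemma measurable_originSeq {E : Type*} [Zero E] [MeasurableSpace E] {k : ℕ} (i : ℕ) :
    Measurable fun x : Fin k → E => originSeq x i := by
  rcases i with _ | i
  · exact measurable_const
  · simp only [originSeq]
    split_ifs
    · exact measurable_pi_apply _
    · exact measurable_const

lemma measurable_chainRadius_originSeq {m : ℕ} (i : ℕ) :
    Measurable fun x : Fin (m + 1) → EuclideanSpace ℝ (Fin d) => chainRadius m (originSeq x) i :=
  (measurable_originSeq _).dist (measurable_originSeq _)

lemma measurableSet_isSeparatedChain (m : ℕ) : MeasurableSet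
    {x : Fin (m + 1) → EuclideanSpace ℝ (Fin d) | IsSeparatedChain m (originSeq x) 0} := by
  have : {x : Fin (m + 1) → EuclideanSpace ℝ (Fin d) | IsSeparatedChain m (originSeq x) 0} =
      (⋂ i, ⋂ (_ : i < m + 2), ⋂ j, ⋂ (_ : j < m + 2), ⋂ (_ : j ≠ i), ⋂ (_ : j ≠ chainNext m i),
        {x | chainRadius m (originSeq x) i + 0 < dist (originSeq x i) (originSeq x j)}) ∩
      ⋂ i, ⋂ (_ : i < m + 2), {x | 0 < chainRadius m (originSeq x) i} := by
    ext x
    simp only [Set.mem_inter_iff, Set.mem_iInter, Set.mem_ofPred_eq]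
    exact ⟨fun h => ⟨h.far, h.pos⟩, fun h => ⟨h.1, h.2⟩⟩
  rw [this]
  refine MeasurableSet.inter ?_ ?_
  · refine MeasurableSet.iInter fun i => MeasurableSet.iInter fun _ => MeasurableSet.iInter fun j =>
      MeasurableSet.iInter fun _ => MeasurableSet.iInter fun _ => MeasurableSet.iInter fun _ => ?_
    exact measurableSet_lt ((measurable_chainRadius_originSeq i).add_const 0)
      ((measurable_originSeq i).dist (measurable_originSeq j))
  · refine MeasurableSet.iInter fun i => MeasurableSet.iInter fun _ => ?_
    exact measurableSet_lt measurable_const (measurable_chainRadius_originSeq i)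

lemma lintegral_goodSteps_le (m : ℕ) :
    ∫⁻ y : Fin (m + 1) → EuclideanSpace ℝ (Fin d), {y | IsGoodSteps y}.indicator (fun y =>
        ENNReal.ofReal (Real.exp (-(∑ i, radialVolume (y i) + radialVolume (y (Fin.last m)))))) y ≤
      ∫⁻ x : Fin (m + 1) → EuclideanSpace ℝ (Fin d),
        {x | IsSeparatedChain m (originSeq x) 0}.indicator
          (fun x => ENNReal.ofReal (Real.exp (-chainVolume m (originSeq x) 0))) x := by
  have hm : Measurable ({x : Fin (m + 1) → EuclideanSpace ℝ (Fin d) |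
      IsSeparatedChain m (originSeq x) 0}.indicator
        (fun x => ENNReal.ofReal (Real.exp (-chainVolume m (originSeq x) 0)))) := by
    refine Measurable.indicator ?_ (measurableSet_isSeparatedChain m)
    unfold chainVolume
    have := measurable_chainRadius_originSeq (d := d) (m := m)
    fun_prop
  rw [← (measurePreserving_partialSums (m + 1)).lintegral_comp hm]
  refine lintegral_mono fun y => Set.indicator_apply_le' (fun hy => ?_) fun _ => zero_le
  have hs := IsGoodSteps.isSeparatedChain hy
  rw [Set.indicator_of_mem (by exact hs), chainVolume_partialSums]

end PartialSums

/-! ### Exponential distribution of the ball volumes -/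

section RadialMeasure

variable {d : ℕ}

lemma radialVolume_nonneg (y : EuclideanSpace ℝ (Fin d)) : 0 ≤ radialVolume y :=
  ballVolume_nonneg (norm_nonneg y)

@[fun_prop]
lemma continuous_radialVolume : Continuous (radialVolume (d := d)) :=
  continuous_ballVolume.comp continuous_norm

lemma radialVolume_eq (y : EuclideanSpace ℝ (Fin d)) : radialVolume y =
    ‖y‖ ^ d * (volume (Metric.ball (0 : EuclideanSpace ℝ (Fin d)) 1)).toReal := rfl

lemma volume_unitBall_pos :
    0 < (volume (Metric.ball (0 : EuclideanSpace ℝ (Fin d)) 1)).toReal :=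
  ENNReal.toReal_pos (Metric.measure_ball_pos _ _ one_pos).ne' measure_ball_lt_top.ne

lemma volume_radialVolume_le (hd : 1 ≤ d) (t : ℝ) :
    volume {y : EuclideanSpace ℝ (Fin d) | radialVolume y ≤ t} = ENNReal.ofReal t := by
  rcases lt_or_ge t 0 with ht | ht
  · have : {y : EuclideanSpace ℝ (Fin d) | radialVolume y ≤ t} = ∅ := by
      ext y
      simpa using ht.trans_le (radialVolume_nonneg y)
    rw [this, measure_empty, ENNReal.ofReal_of_nonpos ht.le]
  · have hc := volume_unitBall_pos (d := d)
    set c := (volume (Metric.ball (0 : EuclideanSpace ℝ (Fin d)) 1)).toReal with hcdef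
    have hρ : ((t / c) ^ ((d : ℝ)⁻¹)) ^ d = t / c :=
      Real.rpow_inv_natCast_pow (by positivity) (by omega)
    set ρ := (t / c) ^ ((d : ℝ)⁻¹)
    have hρ0 : 0 ≤ ρ := by positivity
    have hball : ballVolume d ρ = t := by
      rw [ballVolume, hρ, ← hcdef, div_mul_cancel₀ _ hc.ne']
    have hset : {y : EuclideanSpace ℝ (Fin d) | radialVolume y ≤ t} = Metric.closedBall 0 ρ := by
      ext y
      rw [Set.mem_ofPred_eq, mem_closedBall_zero_iff, ← hball, radialVolume_eq, ballVolume,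
        mul_le_mul_iff_of_pos_right hc,
        pow_le_pow_iff_left₀ (norm_nonneg y) hρ0 (by omega)]
    rw [hset, volume_closedBall_eq _ hρ0, hball]

/-- The set where the ball volume is at most t is a ball of volume t, for t ≥ 0. Half-lines up to t
have finite measure on both sides, so differences determine the measures. -/
lemma map_radialVolume (hd : 1 ≤ d) :
    (volume : Measure (EuclideanSpace ℝ (Fin d))).map radialVolume =
      (volume : Measure ℝ).restrict (Set.Ici 0) := by
  have h1 : ∀ t, (volume : Measure (EuclideanSpace ℝ (Fin d))).map radialVolume (Set.Iic t) =
      ENNReal.ofReal t := fun t => by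
    rw [Measure.map_apply continuous_radialVolume.measurable measurableSet_Iic]
    exact volume_radialVolume_le hd t
  have h2 : ∀ t, (volume : Measure ℝ).restrict (Set.Ici 0) (Set.Iic t) = ENNReal.ofReal t :=
    fun t => by
      rw [Measure.restrict_apply measurableSet_Iic, Set.inter_comm, Set.Ici_inter_Iic,
        Real.volume_Icc, sub_zero]
  refine (Measure.ext_of_Ioc _ _ fun a b hab => ?_).symm
  rw [← Set.Iic_sdiff_Iic, measure_sdiff (Set.Iic_subset_Iic.2 hab.le)
    measurableSet_Iic.nullMeasurableSet (by rw [h2]; exact ENNReal.ofReal_ne_top),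
    measure_sdiff (Set.Iic_subset_Iic.2 hab.le)
    measurableSet_Iic.nullMeasurableSet (by rw [h1]; exact ENNReal.ofReal_ne_top), h1, h1, h2, h2]

lemma lintegral_radialVolume (hd : 1 ≤ d) {f : ℝ → ENNReal} (hf : Measurable f) :
    ∫⁻ y : EuclideanSpace ℝ (Fin d), f (radialVolume y) = ∫⁻ t in Set.Ici (0 : ℝ), f t := by
  rw [← map_radialVolume hd, lintegral_map hf continuous_radialVolume.measurable]

/-- The distribution of a step of a chain in a Poisson process: the volume of the ball of the step
is exponentially distributed, and the direction is uniform. -/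
noncomputable def stepMeasure (d : ℕ) : Measure (EuclideanSpace ℝ (Fin d)) :=
  volume.withDensity fun y => ENNReal.ofReal (Real.exp (-radialVolume y))

lemma measurable_stepDensity :
    Measurable fun y : EuclideanSpace ℝ (Fin d) => ENNReal.ofReal (Real.exp (-radialVolume y)) := by
  fun_prop

lemma lintegral_stepMeasure {f : EuclideanSpace ℝ (Fin d) → ENNReal} (hf : Measurable f) :
    ∫⁻ y, f y ∂(stepMeasure d) = ∫⁻ y, ENNReal.ofReal (Real.exp (-radialVolume y)) * f y :=
  lintegral_withDensity_eq_lintegral_mul _ measurable_stepDensity hf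

lemma lintegral_stepMeasure_radialVolume (hd : 1 ≤ d) {f : ℝ → ENNReal} (hf : Measurable f) :
    ∫⁻ y, f (radialVolume y) ∂(stepMeasure d) =
      ∫⁻ t in Set.Ici (0 : ℝ), ENNReal.ofReal (Real.exp (-t)) * f t := by
  rw [lintegral_stepMeasure (f := fun y => f (radialVolume y))
    (hf.comp continuous_radialVolume.measurable)]
  exact lintegral_radialVolume hd (f := fun t => ENNReal.ofReal (Real.exp (-t)) * f t)
    (by fun_prop)

lemma isProbabilityMeasure_stepMeasure (hd : 1 ≤ d) : IsProbabilityMeasure (stepMeasure d) := by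
  constructor
  have h := lintegral_stepMeasure_radialVolume hd (f := fun _ => 1) measurable_const
  simp only [mul_one, lintegral_one] at h
  rw [h, ← ofReal_integral_eq_lintegral_ofReal, integral_Ici_eq_integral_Ioi,
    integral_exp_neg_Ioi_zero, ENNReal.ofReal_one]
  · have := integrableOn_exp_neg_Ioi 0
    rwa [← integrableOn_Ici_iff_integrableOn_Ioi] at this
  · exact Eventually.of_forall fun t => (Real.exp_pos _).le

lemma stepMeasure_le_volume (s : Set (EuclideanSpace ℝ (Fin d))) (hs : MeasurableSet s) :
    stepMeasure d s ≤ volume s := by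
  rw [stepMeasure, withDensity_apply _ hs, ← setLIntegral_one]
  refine lintegral_mono fun y => ?_
  rw [ENNReal.ofReal_le_one, Real.exp_le_one_iff, neg_nonpos]
  exact radialVolume_nonneg y

lemma lintegral_fin_prod {E : Type*} [MeasurableSpace E] (μ : Measure E) [SigmaFinite μ] :
    ∀ (k : ℕ) (f : Fin k → E → ENNReal), (∀ i, Measurable (f i)) →
      ∫⁻ y, ∏ i, f i (y i) ∂(Measure.pi fun _ : Fin k => μ) = ∏ i, ∫⁻ y, f i y ∂μ := by
  intro k
  induction k with
  | zero => intro f _; simp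
  | succ k ih =>
    intro f hf
    have he := measurePreserving_piFinSuccAbove (fun _ : Fin (k + 1) => μ) 0
    rw [Fin.prod_univ_succ, ← ih _ fun i => hf i.succ]
    have hg : Measurable fun y : Fin k → E => ∏ i, f i.succ (y i) :=
      Finset.measurable_fun_prod _ fun i _ => (hf i.succ).comp (measurable_pi_apply i)
    have hm : Measurable fun z : E × (Fin k → E) => f 0 z.1 * ∏ i, f i.succ (z.2 i) :=
      ((hf 0).comp measurable_fst).mul (hg.comp measurable_snd)
    rw [← lintegral_prod_mul (hf 0).aemeasurable hg.aemeasurable, ← he.lintegral_comp hm]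
    refine lintegral_congr fun y => ?_
    rw [Fin.prod_univ_succ]
    rfl

/-- This turns the weight exp(-∑ V_i) of the chain integral into the law of independent steps. -/
lemma pi_stepMeasure (hd : 1 ≤ d) (k : ℕ) : (Measure.pi fun _ : Fin k => stepMeasure d) =
    volume.withDensity fun y : Fin k → EuclideanSpace ℝ (Fin d) =>
      ENNReal.ofReal (Real.exp (-∑ i, radialVolume (y i))) := by
  have := isProbabilityMeasure_stepMeasure hd
  refine Measure.pi_eq fun s hs => ?_
  rw [withDensity_apply _ (MeasurableSet.univ_pi hs), ← lintegral_indicator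
    (MeasurableSet.univ_pi hs)]
  have h1 : ∀ i, stepMeasure d (s i) = ∫⁻ y, (s i).indicator
      (fun y => ENNReal.ofReal (Real.exp (-radialVolume y))) y := fun i => by
    rw [stepMeasure, withDensity_apply _ (hs i), lintegral_indicator (hs i)]
  rw [Finset.prod_congr rfl fun i _ => h1 i, ← lintegral_fin_prod volume k _
    fun i => measurable_stepDensity.indicator (hs i)]
  refine lintegral_congr fun y => ?_
  by_cases hy : y ∈ Set.pi Set.univ s
  · rw [Set.indicator_of_mem hy, ← Finset.sum_neg_distrib, Real.exp_sum,
      ENNReal.ofReal_prod_of_nonneg fun _ _ => (Real.exp_pos _).le]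
    exact Finset.prod_congr rfl fun i _ => (Set.indicator_of_mem (hy i trivial)
      fun y => ENNReal.ofReal (Real.exp (-radialVolume y))).symm
  · rw [Set.indicator_of_notMem hy]
    simp only [Set.mem_univ_pi, not_forall] at hy
    obtain ⟨i, hi⟩ := hy
    exact (Finset.prod_eq_zero (Finset.mem_univ i) (Set.indicator_of_notMem hi _)).symm

end RadialMeasure

/-! ### Decreasing sequences of exponential variables -/

section DecreasingChains

/-- The probability that `n` independent standard exponential variables `V_0, …, V_{n-1}` and a
further one `V_n` satisfy `t > V_0 > ⋯ > V_{n-1}` and `V_n > V_{n-1}`. -/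
noncomputable def decreasingProb (n : ℕ) (t : ℝ) : ℝ :=
  (1 - Real.exp (-t)) ^ n / n.factorial - (1 - Real.exp (-t)) ^ (n + 1) / (n + 1).factorial

lemma decreasingProb_nonneg (n : ℕ) {t : ℝ} (ht : 0 ≤ t) : 0 ≤ decreasingProb n t := by
  have h1 : 0 ≤ 1 - Real.exp (-t) := by
    have := Real.exp_le_one_iff.2 (neg_nonpos.2 ht); linarith
  have h2 : 1 - Real.exp (-t) ≤ 1 := by have := Real.exp_pos (-t); linarith
  refine sub_nonneg.2 (div_le_div₀ (by positivity) (pow_le_pow_of_le_one h1 h2 (Nat.le_succ n))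
    (by positivity) ?_)
  exact_mod_cast Nat.factorial_le (Nat.le_succ n)

lemma continuous_decreasingProb (n : ℕ) : Continuous (decreasingProb n) := by
  unfold decreasingProb; fun_prop

/-- The infinitesimal form of conditioning on V_0 = s, which has density exp(-s) and leaves the same
problem with one variable fewer below s. -/
lemma hasDerivAt_decreasingProb (n : ℕ) (t : ℝ) :
    HasDerivAt (decreasingProb (n + 1)) (Real.exp (-t) * decreasingProb n t) t := by
  have h1 : HasDerivAt (fun t : ℝ => 1 - Real.exp (-t)) (Real.exp (-t)) t := by
    have := ((hasDerivAt_neg t).exp).const_sub 1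
    simpa using this
  have h2 := ((h1.pow (n + 1)).div_const ((n + 1).factorial : ℝ)).sub
    ((h1.pow (n + 2)).div_const ((n + 2).factorial : ℝ))
  refine h2.congr_deriv ?_
  have e1 : ((n + 1).factorial : ℝ) = (n + 1) * n.factorial := by
    rw [Nat.factorial_succ]; push_cast; ring
  have e2 : ((n + 2).factorial : ℝ) = (n + 2) * (n + 1).factorial := by
    rw [Nat.factorial_succ]; push_cast; ring
  have : (n.factorial : ℝ) ≠ 0 := by positivity
  rw [decreasingProb, e2, e1]
  simp only [Nat.add_sub_cancel, Nat.add_succ_sub_one]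
  push_cast
  field_simp

lemma lintegral_decreasingProb (n : ℕ) {t : ℝ} (ht : 0 ≤ t) :
    ∫⁻ s in Set.Ici (0 : ℝ), ENNReal.ofReal (Real.exp (-s)) *
      (if s < t then ENNReal.ofReal (decreasingProb n s) else 0) =
      ENNReal.ofReal (decreasingProb (n + 1) t) := by
  have hcont : Continuous fun s => Real.exp (-s) * decreasingProb n s :=
    (by fun_prop : Continuous fun s : ℝ => Real.exp (-s)).mul (continuous_decreasingProb n)
  have h1 : ∀ s, ENNReal.ofReal (Real.exp (-s)) *
      (if s < t then ENNReal.ofReal (decreasingProb n s) else 0) =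
      (Set.Iio t).indicator (fun s => ENNReal.ofReal (Real.exp (-s) * decreasingProb n s)) s := by
    intro s
    by_cases hs : s < t
    · rw [if_pos hs, Set.indicator_of_mem (by exact hs), ENNReal.ofReal_mul (Real.exp_pos _).le]
    · rw [if_neg hs, Set.indicator_of_notMem (by exact hs), mul_zero]
  simp_rw [h1]
  rw [lintegral_indicator measurableSet_Iio, Measure.restrict_restrict measurableSet_Iio,
    Set.inter_comm, Set.Ici_inter_Iio, ← ofReal_integral_eq_lintegral_ofReal,
    integral_Ico_eq_integral_Ioc, ← intervalIntegral.integral_of_le ht,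
    intervalIntegral.integral_eq_sub_of_hasDerivAt (fun s _ => hasDerivAt_decreasingProb n s)
      (hcont.intervalIntegrable _ _)]
  · congr 1
    simp [decreasingProb]
  · exact (hcont.integrableOn_Icc).mono_set Set.Ico_subset_Icc_self
  · refine (ae_restrict_iff' measurableSet_Ico).2 (Eventually.of_forall fun s hs => ?_)
    exact mul_nonneg (Real.exp_pos _).le (decreasingProb_nonneg n hs.1)

variable {d : ℕ}

/-- The weight of a sequence of steps with decreasing volumes below `t`: the probability that the
last point of the chain has no point nearer than its predecessor. -/
noncomputable def stepWeight : (n : ℕ) → (Fin n → EuclideanSpace ℝ (Fin d)) → ℝ → ENNReal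
  | 0, _, t => ENNReal.ofReal (Real.exp (-t))
  | n + 1, y, t => if radialVolume (y 0) < t then
      stepWeight n (fun i => y i.succ) (radialVolume (y 0)) else 0

lemma measurable_stepWeight (n : ℕ) :
    Measurable fun z : (Fin n → EuclideanSpace ℝ (Fin d)) × ℝ => stepWeight n z.1 z.2 := by
  induction n with
  | zero => simp only [stepWeight]; fun_prop
  | succ n ih =>
    simp only [stepWeight]
    refine Measurable.ite (measurableSet_lt (by fun_prop) (by fun_prop)) ?_ measurable_const
    exact ih.comp (f := fun z : (Fin (n + 1) → EuclideanSpace ℝ (Fin d)) × ℝ =>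
      (fun i : Fin n => z.1 i.succ, radialVolume (z.1 0))) (by fun_prop)

lemma lintegral_stepWeight (hd : 1 ≤ d) (n : ℕ) : ∀ {t : ℝ}, 0 ≤ t →
    ∫⁻ y, stepWeight n y t ∂(Measure.pi fun _ : Fin n => stepMeasure d) =
      ENNReal.ofReal (decreasingProb n t) := by
  have := isProbabilityMeasure_stepMeasure hd
  induction n with
  | zero => intro t _; simp [stepWeight, decreasingProb]
  | succ n ih =>
    intro t ht
    have he := measurePreserving_piFinSuccAbove (fun _ : Fin (n + 1) => stepMeasure d) 0
    have hm : Measurable fun z : EuclideanSpace ℝ (Fin d) × (Fin n → EuclideanSpace ℝ (Fin d)) =>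
        if radialVolume z.1 < t then stepWeight n z.2 (radialVolume z.1) else 0 := by
      refine Measurable.ite (measurableSet_lt (by fun_prop) (by fun_prop)) ?_ measurable_const
      exact (measurable_stepWeight n).comp
        (f := fun z : EuclideanSpace ℝ (Fin d) × (Fin n → EuclideanSpace ℝ (Fin d)) =>
          (z.2, radialVolume z.1)) (by fun_prop)
    have hF : Measurable fun s => if s < t then ENNReal.ofReal (decreasingProb n s) else 0 :=
      Measurable.ite measurableSet_Iio
        (continuous_decreasingProb n).measurable.ennreal_ofReal measurable_const
    calc _ = ∫⁻ z, (if radialVolume z.1 < t then stepWeight n z.2 (radialVolume z.1) else 0)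
          ∂((stepMeasure d).prod (Measure.pi fun _ : Fin n => stepMeasure d)) :=
          he.lintegral_comp hm
      _ = ∫⁻ y, (if radialVolume y < t then ENNReal.ofReal (decreasingProb n (radialVolume y))
            else 0) ∂(stepMeasure d) := by
          rw [lintegral_prod _ hm.aemeasurable]
          refine lintegral_congr fun y => ?_
          split_ifs
          · exact ih (radialVolume_nonneg y)
          · simp
      _ = _ := by
          rw [lintegral_stepMeasure_radialVolume hd hF, lintegral_decreasingProb n ht]

/-- Unfolds the recursion: the weight is supported on decreasing volumes below `t`, and there it
depends only on the last step. -/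
lemma stepWeight_succ (n : ℕ) : ∀ (y : Fin (n + 1) → EuclideanSpace ℝ (Fin d)) (t : ℝ),
    stepWeight (n + 1) y t ≠ 0 → radialVolume (y 0) < t ∧
      (∀ i : Fin n, radialVolume (y i.succ) < radialVolume (y i.castSucc)) ∧
      stepWeight (n + 1) y t = ENNReal.ofReal (Real.exp (-radialVolume (y (Fin.last n)))) := by
  induction n with
  | zero =>
    intro y t h
    rw [stepWeight] at h ⊢
    split_ifs at h ⊢ with h0
    · exact ⟨h0, fun i => i.elim0, rfl⟩
    · exact absurd rfl h
  | succ n ih =>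
    intro y t h
    rw [stepWeight] at h ⊢
    split_ifs at h ⊢ with h0
    · obtain ⟨h1, h2, h3⟩ := ih _ _ h
      exact ⟨h0, Fin.cases h1 h2, h3⟩
    · exact absurd rfl h

end DecreasingChains

/-! ### Near orthogonality in high dimension -/

section Directions

variable {d : ℕ}

lemma measurable_inner_sq_div (u : EuclideanSpace ℝ (Fin d)) : Measurable
    fun z : EuclideanSpace ℝ (Fin d) => ENNReal.ofReal (inner ℝ u z ^ 2 / ‖z‖ ^ 2) :=
  (Measurable.div (by fun_prop) (by fun_prop)).ennreal_ofReal

/-- The rotation invariance of the distribution of a step, for the second moments of the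
direction. -/
lemma lintegral_inner_sq_eq {u v : EuclideanSpace ℝ (Fin d)} (h : ‖u‖ = ‖v‖) :
    ∫⁻ z, ENNReal.ofReal (inner ℝ u z ^ 2 / ‖z‖ ^ 2) ∂(stepMeasure d) =
      ∫⁻ z, ENNReal.ofReal (inner ℝ v z ^ 2 / ‖z‖ ^ 2) ∂(stepMeasure d) := by
  -- For vectors of equal length, the reflection in the hyperplane orthogonal to `u - v` exchanges
  -- them; it preserves norms and volume.
  set T := (ℝ ∙ (u - v))ᗮ.reflection with hT
  have hTu : T u = v := Submodule.reflection_sub h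
  rw [lintegral_stepMeasure (measurable_inner_sq_div u),
    lintegral_stepMeasure (measurable_inner_sq_div v),
    ← T.measurePreserving.lintegral_comp (f := fun y => ENNReal.ofReal (Real.exp (-radialVolume y)) *
      ENNReal.ofReal (inner ℝ v y ^ 2 / ‖y‖ ^ 2))
      (measurable_stepDensity.mul (measurable_inner_sq_div v))]
  refine lintegral_congr fun z => ?_
  simp only [radialVolume, LinearIsometryEquiv.norm_map]
  rw [← hTu, LinearIsometryEquiv.inner_map_map]

/-- The d squared coordinates of the direction have equal means by rotation invariance and add up to
at most 1. -/
lemma lintegral_inner_sq_le (hd : 1 ≤ d) {u : EuclideanSpace ℝ (Fin d)} (hu : ‖u‖ = 1) :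
    ∫⁻ z, ENNReal.ofReal (inner ℝ u z ^ 2 / ‖z‖ ^ 2) ∂(stepMeasure d) ≤ (d : ENNReal)⁻¹ := by
  have := isProbabilityMeasure_stepMeasure hd
  let b := EuclideanSpace.basisFun (Fin d) ℝ
  have h1 : ∑ i, ∫⁻ z, ENNReal.ofReal (inner ℝ (b i) z ^ 2 / ‖z‖ ^ 2) ∂(stepMeasure d) ≤ 1 := by
    rw [← lintegral_finsetSum _ fun i _ => measurable_inner_sq_div (b i)]
    calc _ ≤ ∫⁻ _, 1 ∂(stepMeasure d) := by
          refine lintegral_mono fun z => ?_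
          rw [← ENNReal.ofReal_sum_of_nonneg fun i _ => by positivity, ← Finset.sum_div,
            b.sum_sq_inner_right z, ENNReal.ofReal_le_one]
          exact div_self_le_one _
      _ = 1 := by simp
  have h2 : ∀ i, ∫⁻ z, ENNReal.ofReal (inner ℝ (b i) z ^ 2 / ‖z‖ ^ 2) ∂(stepMeasure d) =
      ∫⁻ z, ENNReal.ofReal (inner ℝ u z ^ 2 / ‖z‖ ^ 2) ∂(stepMeasure d) := fun i =>
    lintegral_inner_sq_eq (by rw [hu]; exact b.orthonormal.1 i)
  rw [Finset.sum_congr rfl fun i _ => h2 i, Finset.sum_const, Finset.card_univ, Fintype.card_fin,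
    nsmul_eq_mul, mul_comm] at h1
  rw [← one_div]
  exact (ENNReal.le_div_iff_mul_le (Or.inl (by simp; omega)) (Or.inl (by simp))).2 h1

/-- Chebyshev's inequality for the component of the direction of `z` along `y`. -/
lemma stepMeasure_inner_gt_le (hd : 1 ≤ d) (y : EuclideanSpace ℝ (Fin d)) {η : ℝ} (hη : 0 < η) :
    stepMeasure d {z | η * ‖y‖ * ‖z‖ < |inner ℝ y z|} ≤ ENNReal.ofReal (1 / (d * η ^ 2)) := by
  by_cases hy : y = 0
  · simp [hy]
  have hy0 : 0 < ‖y‖ := norm_pos_iff.2 hy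
  set u := ‖y‖⁻¹ • y with hu
  have hu1 : ‖u‖ = 1 := by rw [hu, norm_smul, norm_inv, norm_norm, inv_mul_cancel₀ hy0.ne']
  have hsub : {z | η * ‖y‖ * ‖z‖ < |inner ℝ y z|} ⊆
      {z | ENNReal.ofReal (η ^ 2) ≤ ENNReal.ofReal (inner ℝ u z ^ 2 / ‖z‖ ^ 2)} := by
    intro z hz
    have hz0 : 0 < ‖z‖ := by
      refine norm_pos_iff.2 fun h => ?_
      simp [h] at hz
    refine ENNReal.ofReal_le_ofReal ((le_div_iff₀ (by positivity)).2 ?_)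
    have h1 : inner ℝ y z = ‖y‖ * inner ℝ u z := by
      rw [hu, real_inner_smul_left, ← mul_assoc, mul_inv_cancel₀ hy0.ne', one_mul]
    have h2 : η * ‖z‖ ≤ |inner ℝ u z| := by
      rw [Set.mem_ofPred_eq, h1, abs_mul, abs_norm] at hz
      have : ‖y‖ * (η * ‖z‖) < ‖y‖ * |inner ℝ u z| := by linarith
      exact (lt_of_mul_lt_mul_left this hy0.le).le
    rw [← mul_pow, ← sq_abs (inner ℝ u z)]
    exact pow_le_pow_left₀ (by positivity) h2 2
  have hM := mul_meas_ge_le_lintegral (μ := stepMeasure d) (measurable_inner_sq_div u)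
    (ENNReal.ofReal (η ^ 2))
  have h3 := hM.trans (lintegral_inner_sq_le hd hu1)
  have h4 : (d : ENNReal)⁻¹ = ENNReal.ofReal ((d : ℝ)⁻¹) := by
    rw [ENNReal.ofReal_inv_of_pos (by exact_mod_cast hd), ENNReal.ofReal_natCast]
  have hη2 : 0 < η ^ 2 := by positivity
  have h5 : ENNReal.ofReal (1 / (d * η ^ 2)) =
      ENNReal.ofReal ((d : ℝ)⁻¹) / ENNReal.ofReal (η ^ 2) := by
    rw [← ENNReal.ofReal_div_of_pos hη2, one_div, mul_inv, div_eq_mul_inv]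
  rw [h5, ← h4]
  refine (measure_mono hsub).trans ?_
  rw [ENNReal.le_div_iff_mul_le (Or.inl (by simpa using hη.ne')) (Or.inl ENNReal.ofReal_ne_top),
    mul_comm]
  exact h3

lemma pi_stepMeasure_inner_gt_le (hd : 1 ≤ d) {k : ℕ} {a b : Fin k} (hab : a ≠ b) {η : ℝ}
    (hη : 0 < η) : (Measure.pi fun _ : Fin k => stepMeasure d)
      {y | η * ‖y a‖ * ‖y b‖ < |inner ℝ (y a) (y b)|} ≤ ENNReal.ofReal (1 / (d * η ^ 2)) := by
  have := isProbabilityMeasure_stepMeasure hd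
  have hind : IndepFun (fun y : Fin k → EuclideanSpace ℝ (Fin d) => y a) (fun y => y b)
      (Measure.pi fun _ : Fin k => stepMeasure d) :=
    (iIndepFun_pi (X := fun (_ : Fin k) (y : EuclideanSpace ℝ (Fin d)) => y)
      fun _ => aemeasurable_id).indepFun hab
  rw [indepFun_iff_map_prod_eq_prod_map_map (measurable_pi_apply a).aemeasurable
    (measurable_pi_apply b).aemeasurable] at hind
  have hev : ∀ c : Fin k, (Measure.pi fun _ : Fin k => stepMeasure d).map (fun y => y c) =
      stepMeasure d := fun c => (measurePreserving_eval (fun _ => stepMeasure d) c).map_eq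
  rw [hev, hev] at hind
  have hm : MeasurableSet {z : EuclideanSpace ℝ (Fin d) × EuclideanSpace ℝ (Fin d) |
      η * ‖z.1‖ * ‖z.2‖ < |inner ℝ z.1 z.2|} :=
    (isOpen_lt (by fun_prop) (by fun_prop)).measurableSet
  have h1 := congrArg (fun ν => ν {z : EuclideanSpace ℝ (Fin d) × EuclideanSpace ℝ (Fin d) |
      η * ‖z.1‖ * ‖z.2‖ < |inner ℝ z.1 z.2|}) hind
  rw [Measure.map_apply (by fun_prop) hm, Measure.prod_apply hm] at h1
  refine (le_of_eq h1).trans ?_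
  calc _ ≤ ∫⁻ _, ENNReal.ofReal (1 / (d * η ^ 2)) ∂(stepMeasure d) :=
        lintegral_mono fun y => stepMeasure_inner_gt_le hd y hη
    _ = _ := by simp

lemma radialVolume_lt_iff (hd : 1 ≤ d) {y z : EuclideanSpace ℝ (Fin d)} :
    radialVolume y < radialVolume z ↔ ‖y‖ < ‖z‖ := by
  rw [radialVolume_eq, radialVolume_eq, mul_lt_mul_iff_of_pos_right volume_unitBall_pos,
    pow_lt_pow_iff_left₀ (norm_nonneg y) (norm_nonneg z) (by omega)]

/-- The ratio of the lengths is the d-th root of the ratio of the volumes, which is below M / δ; the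
hypothesis `hMδ` makes that root at most √2. -/
lemma norm_sq_le_of_radialVolume (hd : 1 ≤ d) {M δ : ℝ} (hδ : 0 < δ)
    (hMδ : M ^ 2 ≤ 2 ^ d * δ ^ 2) {y z : EuclideanSpace ℝ (Fin d)} (hy : radialVolume y < M)
    (hz : δ < radialVolume z) : ‖y‖ ^ 2 ≤ 2 * ‖z‖ ^ 2 := by
  by_contra! h
  have h1 : (2 * ‖z‖ ^ 2) ^ d < (‖y‖ ^ 2) ^ d := pow_lt_pow_left₀ h (by positivity) (by omega)
  have hc := volume_unitBall_pos (d := d)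
  rw [radialVolume_eq] at hy hz
  set c := (volume (Metric.ball (0 : EuclideanSpace ℝ (Fin d)) 1)).toReal
  have h2 : (‖y‖ ^ d * c) ^ 2 ≤ M ^ 2 := pow_le_pow_left₀ (by positivity) hy.le 2
  have h3 : δ ^ 2 ≤ (‖z‖ ^ d * c) ^ 2 := pow_le_pow_left₀ hδ.le hz.le 2
  have h4 : 2 ^ d * (‖z‖ ^ d * c) ^ 2 < (‖y‖ ^ d * c) ^ 2 := by
    calc 2 ^ d * (‖z‖ ^ d * c) ^ 2 = (2 * ‖z‖ ^ 2) ^ d * c ^ 2 := by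
          rw [mul_pow, mul_pow, ← pow_mul, ← pow_mul, mul_comm d 2]; ring
      _ < (‖y‖ ^ 2) ^ d * c ^ 2 := by gcongr
      _ = (‖y‖ ^ d * c) ^ 2 := by rw [mul_pow, ← pow_mul, ← pow_mul, mul_comm d 2]
  have h5 : (2 : ℝ) ^ d * δ ^ 2 ≤ 2 ^ d * (‖z‖ ^ d * c) ^ 2 := by gcongr
  linarith

/-- Steps of decreasing, comparable lengths that are nearly orthogonal are the steps of a separated
chain. -/
lemma isGoodSteps_of_nearly_orthogonal (hd : 1 ≤ d) {m : ℕ}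
    {y : Fin (m + 1) → EuclideanSpace ℝ (Fin d)} {M δ η : ℝ} (hδ : 0 < δ)
    (hMδ : M ^ 2 ≤ 2 ^ d * δ ^ 2) (hη : 0 ≤ η) (hη' : ((m : ℝ) + 1) ^ 2 * η ≤ 1 / 4)
    (h0 : radialVolume (y 0) < M) (hlast : δ < radialVolume (y (Fin.last m)))
    (hanti : ∀ i : Fin m, radialVolume (y i.succ) < radialVolume (y i.castSucc))
    (horth : ∀ a b, a ≠ b → |inner ℝ (y a) (y b)| ≤ η * ‖y a‖ * ‖y b‖) : IsGoodSteps y := by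
  have hsa : StrictAnti fun i => radialVolume (y i) := Fin.strictAnti_iff_succ_lt.2 hanti
  have hM : ∀ i, radialVolume (y i) < M := fun i => (hsa.antitone (Fin.zero_le i)).trans_lt h0
  have hδi : ∀ i, δ < radialVolume (y i) := fun i => hlast.trans_le (hsa.antitone (Fin.le_last i))
  have hnorm : ∀ i j, i < j → ‖y j‖ < ‖y i‖ := fun i j hij => (radialVolume_lt_iff hd).1 (hsa hij)
  have hpos : ∀ i, 0 < ‖y i‖ := fun i => by
    refine norm_pos_iff.2 fun h => ?_
    have := hδi i
    rw [radialVolume_eq, h, norm_zero, zero_pow (by omega), zero_mul] at this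
    linarith
  refine ⟨hpos, hnorm, fun i j hij hj => ?_⟩
  set I := Finset.univ.filter fun a : Fin (m + 1) => (i : ℕ) ≤ a ∧ (a : ℕ) < j with hI
  set R := ‖y i‖ with hR
  have hle : ∀ a ∈ I, ‖y a‖ ≤ R := fun a ha => by
    rcases (Fin.le_def.2 (Finset.mem_filter.1 ha).2.1 : i ≤ a).eq_or_lt with rfl | h
    · exact le_rfl
    · exact (hnorm i a h).le
  have hinner : ∀ a ∈ I, ∀ b ∈ I,
      (if a = b then ‖y a‖ ^ 2 else 0) - η * R ^ 2 ≤ inner ℝ (y a) (y b) := fun a ha b hb => by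
    by_cases hab : a = b
    · rw [if_pos hab, ← hab, real_inner_self_eq_norm_sq]
      have : 0 ≤ η * R ^ 2 := by positivity
      linarith
    · rw [if_neg hab]
      have h1 := horth a b hab
      have h2 : η * ‖y a‖ * ‖y b‖ ≤ η * R ^ 2 := by
        rw [mul_assoc, sq]
        exact mul_le_mul_of_nonneg_left (mul_le_mul (hle a ha) (hle b hb) (norm_nonneg _)
          (norm_nonneg _)) hη
      have h3 := neg_abs_le (inner ℝ (y a) (y b))
      linarith
  have hsum : ∑ a ∈ I, ‖y a‖ ^ 2 - (I.card : ℝ) ^ 2 * (η * R ^ 2) ≤ ‖∑ a ∈ I, y a‖ ^ 2 := by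
    rw [← real_inner_self_eq_norm_sq (∑ a ∈ I, y a), sum_inner]
    simp only [inner_sum]
    refine le_trans (le_of_eq ?_) (Finset.sum_le_sum fun a ha => Finset.sum_le_sum fun b hb =>
      hinner a ha b hb)
    simp only [Finset.sum_sub_distrib, Finset.sum_const, nsmul_eq_mul, Finset.sum_ite_eq]
    rw [Finset.sum_congr rfl fun a ha => if_pos ha]
    ring
  -- The sum contains at least the steps `i` and `i + 1`. Their squares add up to at least 3/2 of `R
  -- ^ 2`, and the error terms cost at most 1/4 of it, which leaves more than `R ^ 2`.
  have hi1 : (i : ℕ) + 1 < m + 1 := by omega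
  let i' : Fin (m + 1) := ⟨i + 1, hi1⟩
  have hii' : i ≠ i' := fun h => by
    have : (i : ℕ) = i + 1 := congrArg Fin.val h
    omega
  have hpair : R ^ 2 + ‖y i'‖ ^ 2 ≤ ∑ a ∈ I, ‖y a‖ ^ 2 := by
    rw [hR, ← Finset.sum_pair hii' (f := fun a => ‖y a‖ ^ 2)]
    refine Finset.sum_le_sum_of_subset_of_nonneg (fun a ha => ?_) fun _ _ _ => by positivity
    rw [Finset.mem_insert, Finset.mem_singleton] at ha
    rw [hI, Finset.mem_filter]
    rcases ha with rfl | rfl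
    · exact ⟨Finset.mem_univ _, le_rfl, by omega⟩
    · exact ⟨Finset.mem_univ _, Nat.le_succ _, by change (i : ℕ) + 1 < j; omega⟩
  have hcomp : R ^ 2 ≤ 2 * ‖y i'‖ ^ 2 := norm_sq_le_of_radialVolume hd hδ hMδ (hM i) (hδi i')
  have hcard : (I.card : ℝ) ^ 2 * (η * R ^ 2) ≤ 1 / 4 * R ^ 2 := by
    have h1 : (I.card : ℝ) ≤ m + 1 := by
      have := Finset.card_le_univ I
      rw [Fintype.card_fin] at this
      exact_mod_cast this
    calc (I.card : ℝ) ^ 2 * (η * R ^ 2) ≤ ((m : ℝ) + 1) ^ 2 * (η * R ^ 2) := by gcongr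
      _ = ((m : ℝ) + 1) ^ 2 * η * R ^ 2 := by ring
      _ ≤ 1 / 4 * R ^ 2 := by gcongr
  have hRpos : 0 < R ^ 2 := by have := hpos i; positivity
  exact lt_of_pow_lt_pow_left₀ 2 (norm_nonneg _) (by linarith)

end Directions

/-! ### Explicit lower bound in a fixed dimension -/

section HighDimension

variable {d : ℕ}

lemma lintegral_stepMeasure_goodSteps_le (hd : 1 ≤ d) (m : ℕ) :
    ∫⁻ y, {y : Fin (m + 1) → EuclideanSpace ℝ (Fin d) | IsGoodSteps y}.indicator (fun y =>
        ENNReal.ofReal (Real.exp (-radialVolume (y (Fin.last m))))) y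
        ∂(Measure.pi fun _ : Fin (m + 1) => stepMeasure d) ≤
    ∫⁻ y : Fin (m + 1) → EuclideanSpace ℝ (Fin d), {y | IsGoodSteps y}.indicator (fun y =>
        ENNReal.ofReal
          (Real.exp (-(∑ i, radialVolume (y i) + radialVolume (y (Fin.last m)))))) y := by
  rw [pi_stepMeasure hd]
  refine (lintegral_withDensity_le_lintegral_mul _ (by fun_prop) _).trans ?_
  refine lintegral_mono fun y => ?_
  by_cases hy : IsGoodSteps y
  · rw [Pi.mul_apply, Set.indicator_of_mem (by exact hy), Set.indicator_of_mem (by exact hy),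
      ← ENNReal.ofReal_mul (Real.exp_pos _).le, ← Real.exp_add, neg_add]
  · rw [Pi.mul_apply, Set.indicator_of_notMem (by exact hy), mul_zero]
    exact zero_le

/-- The left side is the total mass of `stepWeight`. Where the last volume exceeds `δ` and all pairs
are nearly orthogonal, decreasing steps are good; on the exceptional set the weight is at most 1, so
its probability bounds the loss. The factor (m + 1)² counts ordered pairs. -/
lemma decreasingProb_le_lintegral (hd : 1 ≤ d) (m : ℕ) {M δ η : ℝ} (hM : 0 ≤ M) (hδ : 0 < δ)
    (hMδ : M ^ 2 ≤ 2 ^ d * δ ^ 2) (hη : 0 < η) (hη' : ((m : ℝ) + 1) ^ 2 * η ≤ 1 / 4) :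
    ENNReal.ofReal (decreasingProb (m + 1) M) ≤
      ∫⁻ y, {y : Fin (m + 1) → EuclideanSpace ℝ (Fin d) | IsGoodSteps y}.indicator (fun y =>
        ENNReal.ofReal (Real.exp (-radialVolume (y (Fin.last m))))) y
        ∂(Measure.pi fun _ : Fin (m + 1) => stepMeasure d) +
      ENNReal.ofReal (δ + ((m : ℝ) + 1) ^ 2 * (1 / (d * η ^ 2))) := by
  have := isProbabilityMeasure_stepMeasure hd
  set ν := Measure.pi fun _ : Fin (m + 1) => stepMeasure d with hν
  let B₁ : Set (Fin (m + 1) → EuclideanSpace ℝ (Fin d)) := {y | radialVolume (y (Fin.last m)) ≤ δ}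
  let B₂ : Fin (m + 1) × Fin (m + 1) → Set (Fin (m + 1) → EuclideanSpace ℝ (Fin d)) :=
    fun z => {y | z.1 ≠ z.2 ∧ η * ‖y z.1‖ * ‖y z.2‖ < |inner ℝ (y z.1) (y z.2)|}
  have hB₁m : MeasurableSet B₁ := (isClosed_le (by fun_prop) (by fun_prop)).measurableSet
  have hB₂m : ∀ z, MeasurableSet (B₂ z) := fun z =>
    (MeasurableSet.const (z.1 ≠ z.2)).inter
      (isOpen_lt (f := fun y : Fin (m + 1) → EuclideanSpace ℝ (Fin d) => η * ‖y z.1‖ * ‖y z.2‖)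
        (g := fun y => |inner ℝ (y z.1) (y z.2)|) (by fun_prop) (by fun_prop)).measurableSet
  have hBm : MeasurableSet (B₁ ∪ ⋃ z, B₂ z) := hB₁m.union (MeasurableSet.iUnion hB₂m)
  have hB₁ : ν B₁ ≤ ENNReal.ofReal δ := by
    have h1 : MeasurableSet {y : EuclideanSpace ℝ (Fin d) | radialVolume y ≤ δ} :=
      (isClosed_le (by fun_prop) (by fun_prop)).measurableSet
    have h2 := (measurePreserving_eval (fun _ : Fin (m + 1) => stepMeasure d)
      (Fin.last m)).measure_preimage h1.nullMeasurableSet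
    rw [← volume_radialVolume_le hd]
    exact (le_of_eq h2).trans (stepMeasure_le_volume _ h1)
  have hB₂ : ∀ z, ν (B₂ z) ≤ ENNReal.ofReal (1 / (d * η ^ 2)) := fun z => by
    by_cases hz : z.1 = z.2
    · simp [B₂, hz]
    · exact (measure_mono fun y hy => hy.2).trans (pi_stepMeasure_inner_gt_le hd hz hη)
  have hB : ν (B₁ ∪ ⋃ z, B₂ z) ≤ ENNReal.ofReal (δ + ((m : ℝ) + 1) ^ 2 * (1 / (d * η ^ 2))) := by
    rw [ENNReal.ofReal_add hδ.le (by positivity)]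
    refine (measure_union_le _ _).trans (add_le_add hB₁ ?_)
    refine (measure_iUnion_fintype_le _ _).trans ((Finset.sum_le_sum fun z _ => hB₂ z).trans ?_)
    rw [Finset.sum_const, Finset.card_univ, Fintype.card_prod, Fintype.card_fin, nsmul_eq_mul,
      ENNReal.ofReal_mul (by positivity), ← sq, Nat.cast_pow, ENNReal.ofReal_pow (by positivity)]
    gcongr
    rw [← Nat.cast_succ, ENNReal.ofReal_natCast]
  rw [← lintegral_stepWeight hd (m + 1) hM]
  calc ∫⁻ y, stepWeight (m + 1) y M ∂ν
      ≤ ∫⁻ y, ({y : Fin (m + 1) → EuclideanSpace ℝ (Fin d) | IsGoodSteps y}.indicator (fun y =>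
          ENNReal.ofReal (Real.exp (-radialVolume (y (Fin.last m))))) y +
          (B₁ ∪ ⋃ z, B₂ z).indicator 1 y) ∂ν := by
        refine lintegral_mono fun y => ?_
        by_cases hw : stepWeight (m + 1) y M = 0
        · rw [hw]; exact zero_le
        obtain ⟨h1, h2, h3⟩ := stepWeight_succ m y M hw
        by_cases hy : y ∈ B₁ ∪ ⋃ z, B₂ z
        · rw [Set.indicator_of_mem hy, h3]
          refine le_add_of_nonneg_of_le zero_le ?_
          rw [Pi.one_apply, ENNReal.ofReal_le_one, Real.exp_le_one_iff, neg_nonpos]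
          exact radialVolume_nonneg _
        · simp only [Set.mem_union, Set.mem_iUnion, not_or, not_exists] at hy
          have hgood : IsGoodSteps y := isGoodSteps_of_nearly_orthogonal hd hδ hMδ hη.le hη' h1
            (not_le.1 hy.1) h2 fun a b hab => not_lt.1 fun h => hy.2 (a, b) ⟨hab, h⟩
          rw [Set.indicator_of_mem (by exact hgood), h3]
          exact le_self_add
    _ = _ := lintegral_add_right _ (measurable_one.indicator hBm)
    _ ≤ _ := by
        rw [lintegral_indicator_one hBm]
        gcongr

lemma IsUnitPoissonProcess.decreasingProb_le_measureReal {Ω : Type*} [MeasurableSpace Ω]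
    {P : Measure Ω} [IsProbabilityMeasure P] {X : Ω → Set (EuclideanSpace ℝ (Fin d))}
    (hX : IsUnitPoissonProcess P X) (hd : 1 ≤ d) (m : ℕ) {M δ η : ℝ} (hM : 0 ≤ M) (hδ : 0 < δ)
    (hMδ : M ^ 2 ≤ 2 ^ d * δ ^ 2) (hη : 0 < η) (hη' : ((m : ℝ) + 1) ^ 2 * η ≤ 1 / 4) :
    decreasingProb (m + 1) M ≤ P.real (originGenerationEvent X (m + 1)) +
      (δ + ((m : ℝ) + 1) ^ 2 * (1 / (d * η ^ 2))) := by
  have h := (decreasingProb_le_lintegral hd m hM hδ hMδ hη hη').trans (add_le_add_left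
    ((lintegral_stepMeasure_goodSteps_le hd m).trans ((lintegral_goodSteps_le m).trans
      (hX.lintegral_chain_le hd m))) _)
  rw [← ENNReal.ofReal_toReal (measure_ne_top P (originGenerationEvent X (m + 1))),
    ← ENNReal.ofReal_add ENNReal.toReal_nonneg (by positivity)] at h
  exact (ENNReal.ofReal_le_ofReal_iff (add_nonneg ENNReal.toReal_nonneg (by positivity))).1 h

end HighDimension

/-! ### Passage to the limit -/

section Limit

/-- If lower bounds for the terms of subprobability vectors add up to `1`, they are the limits. -/
lemma tendsto_of_eventually_ge_of_sum_le_one {a : ℕ → ℕ → ℝ} {L : ℕ → ℝ}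
    (hlow : ∀ m, ∀ ε > 0, ∀ᶠ d in atTop, L m - ε ≤ a d m)
    (hsum : ∀ N, ∀ᶠ d in atTop, ∑ j ∈ Finset.range N, a d j ≤ 1)
    (hL : Tendsto (fun N => ∑ j ∈ Finset.range N, L j) atTop (𝓝 1)) (m : ℕ) :
    Tendsto (fun d => a d m) atTop (𝓝 (L m)) := by
  rw [Metric.tendsto_atTop']
  intro ε hε
  obtain ⟨N, hN, hNm⟩ := ((hL.eventually_const_lt (show 1 - ε / 3 < 1 by linarith)).and
    (eventually_gt_atTop m)).exists
  have hN0 : (0 : ℝ) < N := by exact_mod_cast (by omega : 0 < N)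
  have hall : ∀ᶠ d in atTop, ∀ j ∈ Finset.range N, L j - ε / (3 * N) ≤ a d j :=
    (Filter.eventually_all_finset _).2 fun j _ => hlow j _ (by positivity)
  obtain ⟨D, hD⟩ := eventually_atTop.1 ((hall.and (hsum N)).and (hlow m (ε / 2) (by positivity)))
  refine ⟨D, fun d hd => ?_⟩
  obtain ⟨⟨h1, h2⟩, h3⟩ := hD d hd.le
  -- All summands are nonnegative, so one of them is at most their total, which is below ε: the sum
  -- of the `a d j` is at most 1, that of the `L j` exceeds 1 - ε / 3, and the corrections add ε /
  -- 3.
  have h4 : a d m - L m + ε / (3 * N) ≤ ∑ j ∈ Finset.range N, (a d j - L j + ε / (3 * N)) :=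
    Finset.single_le_sum (f := fun j => a d j - L j + ε / (3 * N))
      (fun j hj => by have := h1 j hj; linarith) (Finset.mem_range.2 hNm)
  rw [Finset.sum_add_distrib, Finset.sum_sub_distrib, Finset.sum_const, Finset.card_range,
    nsmul_eq_mul] at h4
  have h5 : (N : ℝ) * (ε / (3 * N)) = ε / 3 := by field_simp
  have h6 : 0 < ε / (3 * N) := by positivity
  rw [Real.dist_eq, abs_lt]
  constructor <;> linarith

lemma tendsto_decreasingProb (n : ℕ) : Tendsto (decreasingProb n) atTop
    (𝓝 (1 / n.factorial - 1 / (n + 1).factorial)) := by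
  have h1 : Tendsto (fun t : ℝ => 1 - Real.exp (-t)) atTop (𝓝 1) := by
    simpa using Real.tendsto_exp_neg_atTop_nhds_zero.const_sub 1
  have h2 := ((h1.pow n).div_const (n.factorial : ℝ)).sub
    ((h1.pow (n + 1)).div_const ((n + 1).factorial : ℝ))
  simp only [one_pow] at h2
  exact h2

variable {Ω : ℕ → Type*} [∀ d, MeasurableSpace (Ω d)] {P : ∀ d, Measure (Ω d)}
  [∀ d, IsProbabilityMeasure (P d)] {X : ∀ d, Ω d → Set (EuclideanSpace ℝ (Fin d))}

lemma eventually_le_measureReal_originGenerationEvent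
    (hX : ∀ d, 1 ≤ d → IsUnitPoissonProcess (P d) (X d)) (m : ℕ) {ε : ℝ} (hε : 0 < ε) :
    ∀ᶠ d in atTop, 1 / ((m + 1).factorial : ℝ) - 1 / (m + 2).factorial - ε ≤
      (P d).real (originGenerationEvent (X d) (m + 1)) := by
  -- The loss ε is split in three: cutting off at `M`, the choice `δ = ε / 3`, and failure of
  -- orthogonality. Since `M`, `δ` and `η` do not depend on d, the remaining conditions hold for
  -- large d.
  obtain ⟨M, hM, hM0⟩ := (((tendsto_decreasingProb (m + 1)).eventually_const_lt
    (show 1 / ((m + 1).factorial : ℝ) - 1 / (m + 1 + 1).factorial - ε / 3 <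
      1 / ((m + 1).factorial : ℝ) - 1 / (m + 1 + 1).factorial by linarith)).and
    (eventually_ge_atTop 0)).exists
  set η : ℝ := 1 / (4 * ((m : ℝ) + 1) ^ 2) with hη
  have hη0 : 0 < η := by positivity
  have hη1 : ((m : ℝ) + 1) ^ 2 * η ≤ 1 / 4 := le_of_eq (by rw [hη]; field_simp)
  have h1 : Tendsto (fun d : ℕ => (2 : ℝ) ^ d * (ε / 3) ^ 2) atTop atTop :=
    (tendsto_pow_atTop_atTop_of_one_lt one_lt_two).atTop_mul_const (by positivity)
  have h2 : Tendsto (fun d : ℕ => ((m : ℝ) + 1) ^ 2 * (1 / (d * η ^ 2))) atTop (𝓝 0) := by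
    have h3 : Tendsto (fun d : ℕ => (d : ℝ) * η ^ 2) atTop atTop :=
      tendsto_natCast_atTop_atTop.atTop_mul_const (by positivity)
    simpa using (h3.inv_tendsto_atTop).const_mul (((m : ℝ) + 1) ^ 2)
  filter_upwards [h1.eventually_ge_atTop (M ^ 2), h2.eventually_lt_const (show 0 < ε / 3 by linarith),
    eventually_ge_atTop 1] with d hd1 hd2 hd
  have := (hX d hd).decreasingProb_le_measureReal hd m hM0 (by positivity : 0 < ε / 3) hd1 hη0 hη1
  linarith

lemma sum_measureReal_originGenerationEvent_le_one
    (hX : ∀ d, 1 ≤ d → IsUnitPoissonProcess (P d) (X d)) {d : ℕ} (hd : 1 ≤ d) (N : ℕ) :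
    ∑ j ∈ Finset.range N, (P d).real (originGenerationEvent (X d) (j + 1)) ≤ 1 := by
  have hdisj : (Finset.range N : Set ℕ).PairwiseDisjoint
      fun j => originGenerationEvent (X d) (j + 1) := by
    intro i _ j _ hij
    refine Set.disjoint_left.2 fun ω hi hj => hij ?_
    have h : ((i + 1 : ℕ) : ℕ∞) = ((j + 1 : ℕ) : ℕ∞) := Eq.trans (Eq.symm hi) hj
    have := Nat.cast_injective h
    omega
  rw [← measureReal_biUnion_finset₀ (fun i hi j hj hij => (hdisj hi hj hij).aedisjoint)
    fun j _ => (hX d hd).nullMeasurableSet_originGenerationEvent hd j]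
  exact measureReal_le_one

end Limit

theorem theorem1p3 {Ω : ℕ → Type*} [∀ d, MeasurableSpace (Ω d)]
    (P : ∀ d, Measure (Ω d)) [∀ d, IsProbabilityMeasure (P d)]
    (X : ∀ d, Ω d → Set (EuclideanSpace ℝ (Fin d)))
    (hX : ∀ d, 1 ≤ d → IsUnitPoissonProcess (P d) (X d))
    (k : ℕ) (hk : 1 ≤ k) :
    (∀ d, 1 ≤ d → NullMeasurableSet (originGenerationEvent (X d) k) (P d)) ∧
      Tendsto (fun d => (P d).real (originGenerationEvent (X d) k)) atTop
        (𝓝 ((k : ℝ) / ((k + 1).factorial : ℝ))) := by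
  obtain ⟨m, rfl⟩ : ∃ m, k = m + 1 := ⟨k - 1, by omega⟩
  refine ⟨fun d hd => (hX d hd).nullMeasurableSet_originGenerationEvent hd m, ?_⟩
  have hsum : ∀ N : ℕ, ∑ j ∈ Finset.range N,
      (1 / ((j + 1).factorial : ℝ) - 1 / (j + 2).factorial) = 1 - 1 / (N + 1).factorial :=
    fun N => by
      have := Finset.sum_range_sub' (fun j => 1 / ((j + 1).factorial : ℝ)) N
      simpa using this
  have hfact : Tendsto (fun N : ℕ => 1 - 1 / ((N + 1).factorial : ℝ)) atTop (𝓝 1) := by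
    have h1 : Tendsto (fun N : ℕ => ((N + 1).factorial : ℝ)) atTop atTop :=
      tendsto_natCast_atTop_atTop.comp
        (tendsto_atTop_mono (fun N => Nat.self_le_factorial (N + 1)) (tendsto_add_atTop_nat 1))
    simpa using h1.inv_tendsto_atTop.const_sub 1
  have h := tendsto_of_eventually_ge_of_sum_le_one
    (a := fun d j => (P d).real (originGenerationEvent (X d) (j + 1)))
    (L := fun j => 1 / ((j + 1).factorial : ℝ) - 1 / (j + 2).factorial)
    (fun j ε hε => eventually_le_measureReal_originGenerationEvent hX j hε)
    (fun N => (eventually_ge_atTop 1).mono fun d hd =>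
      sum_measureReal_originGenerationEvent_le_one hX hd N)
    (by simpa only [hsum] using hfact) m
  -- What remains is 1 / k! - 1 / (k + 1)! = k / (k + 1)! with k = m + 1.
  convert h using 2
  have e2 : ((m + 2).factorial : ℝ) = (m + 2) * (m + 1).factorial := by
    rw [Nat.factorial_succ]; push_cast; ring
  have h3 : ((m + 1).factorial : ℝ) ≠ 0 := by positivity
  have h4 : (m : ℝ) + 2 ≠ 0 := by positivity
  rw [show m + 1 + 1 = m + 2 from rfl, e2]
  push_cast
  field_simp
  ring
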